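/- For a real closed field $K$, order $K$ by its unique field ordering ($x \le y$ if and only if $y - x$ is a square); for real closed fields $R \subseteq S$ this ordering of $S$ extends that of $R$. We say that $R$ is Dedekind complete in $S$ if for every $s \in S$ for which there are $a, b \in R$ with $a \le s \le b$, the set $\{x \in R : x \le s\}$ has a least upper bound in $R$. Let $R$ be a real closed field and let $\kappa$ be its cardinality. Then there are real closed fields $M$ and $N$ containing $R$, each of transcendence degree $\kappa$ over $R$, with the following property: for every real closed field $S$ containing $R$, there exist a field embedding $S \to M$ over $R$ and a field embedding $S \to N$ over $R$ (that is, both being the identity on $R$) if and only if $\operatorname{tr.deg}(S/R) \le 1$ and $R$ is Dedekind complete in $S$. -/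

import Mathlib

universe u v

/-- For an extension `S` of an ordered field `R`: `R` is Dedekind complete in `S` if every element
`s` of `S` that lies between two elements of `R` cuts `R` at a point of `R`, that is, the set
`{x ∈ R | x ≤ s}` has a least upper bound in `R`.  (Elements of `S` above or below all of `R`
are unrestricted.) -/
def IsDedekindCompleteIn (R S : Type*) [Field R] [LinearOrder R] [Field S] [LinearOrder S]
    [Algebra R S] : Prop :=
  ∀ s : S, (∃ a b : R, algebraMap R S a ≤ s ∧ s ≤ algebraMap R S b) →
    ∃ r : R, IsLUB {x : R | algebraMap R S x ≤ s} r

/-! Call an element of an ordered extension of `R` infinite if it exceeds all of `R`. The field `M`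
lies in a real closure of the Laurent series field over `R`. There every bounded element is
infinitely close to an element of `R`, and the powers of any infinite element are cofinal. Both
properties survive algebraic extensions and pass to subfields, so `R` is Dedekind complete in each
`S` inside `M`, and the infinite elements of `S` form at most one multiplicative archimedean class.
Yet `M` is large: the series `exp (b t)`, with `b` in a rational basis of `R`, are algebraically
independent.

The field `N` has a transcendence basis of infinite elements `X i` in pairwise distinct
multiplicative archimedean classes. An `S` that embeds in both fields meets the class of at most one
`X i`. The others stay algebraically independent over `S`
(`algebraicIndependent_of_mulArchimedeanClass`), and exchange leaves `S` transcendence degree at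
most one (`IsRankLEOneOver.trdeg_le_one`).

Conversely, Dedekind completeness gives a non-algebraic `S` an infinite element `t`, and `R(t)` is
then ordered by leading coefficients. Sending `t` to an infinite element of `M` or `N` therefore
preserves the order. As `S` is algebraic over `R(t)`, the map extends to `S`
(`HasStandardParts.nonempty_algHom`). The extension rests on counting embeddings by the signature of
a trace form (`IsRealClosed.card_pos_eq_card_neg_add`). The fields themselves are cut out of real
closures of Hahn series fields (`exists_realClosure`). -/

section

/-! ### Adjoining a square root of `-1` to a real closed field makes it algebraically closed. -/

open Polynomial

/-- The complexification of an ordered field. -/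
abbrev Complexification (E : Type*) [Field E] := QuadraticAlgebra E (-1) 0

instance Complexification.fact {E : Type*} [Field E] [LinearOrder E] [IsStrictOrderedRing E] :
    Fact (∀ r : E, r ^ 2 ≠ -1 + 0 * r) :=
  ⟨fun r h => by nlinarith [sq_nonneg r]⟩

/-- A field in which every element is a square has no quadratic extension. -/
theorem finrank_ne_two_of_forall_isSquare {C L : Type*} [Field C] [Field L] [Algebra C L]
    [CharZero C] (h : ∀ x : C, IsSquare x) : Module.finrank C L ≠ 2 := by
  intro h2
  have : FiniteDimensional C L := Module.finite_of_finrank_pos (by omega)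
  have hnt : ∃ x : L, x ∉ (⊥ : IntermediateField C L) := by
    by_contra! hx
    have : (⊥ : IntermediateField C L) = ⊤ := by ext y; simp [hx y]
    have h1 := IntermediateField.finrank_eq_one_iff.2 this.symm
    have : Module.finrank C (⊤ : IntermediateField C L) = 2 := by
      rw [IntermediateField.finrank_top', h2]
    rw [← ‹(⊥ : IntermediateField C L) = ⊤›, IntermediateField.finrank_bot] at this
    omega
  obtain ⟨x, hx⟩ := hnt
  have hint : IsIntegral C x := Algebra.IsIntegral.isIntegral x
  have hdvd : (minpoly C x).natDegree ∣ 2 := h2 ▸ minpoly.degree_dvd hint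
  have hirr := minpoly.irreducible hint
  have hne : (minpoly C x).natDegree ≠ 1 := by
    intro h1
    have h1' : (minpoly C x).degree = 1 := by
      rw [degree_eq_natDegree hirr.ne_zero, h1]; rfl
    obtain ⟨y, hy⟩ := minpoly.mem_range_of_degree_eq_one C x h1'
    exact hx (IntermediateField.mem_bot.2 ⟨y, hy⟩)
  have hdeg : (minpoly C x).natDegree = 2 := by
    have := Nat.le_of_dvd two_pos hdvd
    have := Nat.pos_of_dvd_of_pos hdvd two_pos
    omega
  have hmon := minpoly.monic hint
  set p := minpoly C x with hp
  -- The discriminant is a square, so the quadratic formula gives a root of an irreducible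
  -- quadratic.
  obtain ⟨s, hs⟩ := h (p.coeff 1 ^ 2 - 4 * p.coeff 0)
  obtain ⟨r, hr⟩ := exists_quadratic_eq_zero (a := (1 : C)) (b := p.coeff 1) (c := p.coeff 0)
    one_ne_zero ⟨s, by rw [discrim, ← hs]; ring⟩
  have hroot : p.IsRoot r := by
    have h22 : p.coeff 2 = 1 := by
      have := hmon.coeff_natDegree
      rwa [hdeg] at this
    rw [IsRoot, eval_eq_sum_range, hdeg]
    simp only [Finset.sum_range_succ, Finset.sum_range_zero, h22]
    linear_combination hr
  have := degree_eq_one_of_irreducible_of_root hirr hroot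
  rw [degree_eq_natDegree hirr.ne_zero, hdeg] at this
  norm_num at this

namespace IsRealClosed

/-- A real closed field has no proper extension of odd degree. -/
theorem finrank_eq_one_of_odd {E L : Type*} [Field E] [IsRealClosed E] [Field L] [Algebra E L]
    (h : Odd (Module.finrank E L)) : Module.finrank E L = 1 := by
  have : FiniteDimensional E L := Module.finite_of_finrank_pos h.pos
  obtain ⟨a, ha⟩ := Field.exists_primitive_element E L
  have hint : IsIntegral E a := Algebra.IsIntegral.isIntegral a
  have hf : Module.finrank E L = (minpoly E a).natDegree := by
    rw [← IntermediateField.adjoin.finrank hint, ha, IntermediateField.finrank_top']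
  have hirr := minpoly.irreducible hint
  obtain ⟨r, hr⟩ := exists_isRoot_of_odd_natDegree (hf ▸ h)
  rw [hf]
  exact natDegree_eq_of_degree_eq_some (degree_eq_one_of_irreducible_of_root hirr hr)

variable {E : Type*} [Field E] [LinearOrder E] [IsStrictOrderedRing E] [IsRealClosed E]

theorem exists_sqrt {x : E} (hx : 0 ≤ x) : ∃ y, 0 ≤ y ∧ y ^ 2 = x := by
  obtain ⟨y, rfl⟩ := IsSquare.of_nonneg hx
  exact ⟨|y|, abs_nonneg y, by rw [sq_abs, sq]⟩

/-- Half-angle formulas, with `n` the modulus of `z`. They determine the parts of the root up to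
sign, and the sign of `z.im` decides between `v` and `-v`. -/
theorem isSquare_complexification (z : Complexification E) : IsSquare z := by
  obtain ⟨n, hn, hn2⟩ := exists_sqrt (x := z.re ^ 2 + z.im ^ 2) (by positivity)
  have h1 : |z.re| ≤ n := abs_le_of_sq_le_sq (by nlinarith [sq_nonneg z.im]) hn
  obtain ⟨h1l, h1r⟩ := abs_le.1 h1
  obtain ⟨u, hu, hu2⟩ := exists_sqrt (x := (n + z.re) / 2) (by linarith)
  obtain ⟨v, hv, hv2⟩ := exists_sqrt (x := (n - z.re) / 2) (by linarith)
  have huv : (2 * (u * v)) ^ 2 = z.im ^ 2 := by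
    rw [mul_pow, mul_pow, hu2, hv2]; linear_combination hn2
  rcases sq_eq_sq_iff_eq_or_eq_neg.1 huv with h | h
  · refine ⟨⟨u, v⟩, ?_⟩
    ext
    · simp only [QuadraticAlgebra.re_mul]; linear_combination hv2 - hu2
    · simp only [QuadraticAlgebra.im_mul]; linear_combination -h
  · refine ⟨⟨u, -v⟩, ?_⟩
    ext
    · simp only [QuadraticAlgebra.re_mul]; linear_combination hv2 - hu2
    · simp only [QuadraticAlgebra.im_mul]; linear_combination h

/-- The complexification of a real closed field has no proper finite extension that is Galois
over the real closed field. -/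
theorem finrank_complexification_eq_one (N : Type*) [Field N] [Algebra E N]
    [Algebra (Complexification E) N] [IsScalarTower E (Complexification E) N]
    [FiniteDimensional E N] [IsGalois E N] : Module.finrank (Complexification E) N = 1 := by
  have hfin : FiniteDimensional (Complexification E) N :=
    FiniteDimensional.right E (Complexification E) N
  have : IsGalois (Complexification E) N := IsGalois.tower_top_of_isGalois E _ N
  have htower := Module.finrank_mul_finrank E (Complexification E) N
  rw [QuadraticAlgebra.finrank_eq_two] at htower
  have : Fact (Nat.Prime 2) := ⟨Nat.prime_two⟩
  -- The fixed field of a Sylow 2-subgroup has odd degree over `E`, hence equals `E`.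
  obtain ⟨k, hk⟩ : ∃ k, Module.finrank E N = 2 ^ k := by
    obtain ⟨P⟩ : Nonempty (Sylow 2 Gal(N/E)) := inferInstance
    have h1 := Module.finrank_mul_finrank E (IntermediateField.fixedField (P : Subgroup Gal(N/E))) N
    rw [IntermediateField.finrank_fixedField_eq_card] at h1
    have h2 : Nat.card P * (P : Subgroup Gal(N/E)).index = Module.finrank E N := by
      rw [← IsGalois.card_aut_eq_finrank]; exact Subgroup.card_mul_index _
    have h3 : ¬ 2 ∣ (P : Subgroup Gal(N/E)).index := P.not_dvd_index
    have h4 : Module.finrank E (IntermediateField.fixedField (P : Subgroup Gal(N/E))) =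
        (P : Subgroup Gal(N/E)).index := by
      have hpos : 0 < Nat.card P := Nat.card_pos
      exact Nat.eq_of_mul_eq_mul_left hpos (by rw [h2, mul_comm]; exact h1)
    have h5 := finrank_eq_one_of_odd (E := E)
      (L := IntermediateField.fixedField (P : Subgroup Gal(N/E)))
      (by rw [h4]; exact Nat.odd_iff.2 (by omega))
    obtain ⟨k, hk⟩ := P.isPGroup'.exists_card_eq
    exact ⟨k, by rw [← h1, h5, one_mul]; exact hk⟩
  obtain ⟨m, hm⟩ : ∃ m, Module.finrank (Complexification E) N = 2 ^ m := by
    have := (Nat.dvd_prime_pow Nat.prime_two).1 (Dvd.intro_left _ (htower.trans hk))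
    obtain ⟨m, -, hm⟩ := this
    exact ⟨m, hm⟩
  rcases m with _ | m
  · simpa using hm
  exfalso
  have hcard : Nat.card Gal(N/(Complexification E)) = 2 ^ (m + 1) := by
    rw [IsGalois.card_aut_eq_finrank, hm]
  -- A subgroup of index two would have a quadratic extension of the complexification as its fixed
  -- field.
  obtain ⟨H, hH⟩ := Sylow.exists_subgroup_card_pow_prime (G := Gal(N/(Complexification E))) 2
    (n := m) (by rw [hcard]; exact pow_dvd_pow 2 (Nat.le_succ m))
  have h1 := Module.finrank_mul_finrank (Complexification E) (IntermediateField.fixedField H) N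
  rw [IntermediateField.finrank_fixedField_eq_card, hH, hm, pow_succ, mul_comm] at h1
  exact finrank_ne_two_of_forall_isSquare isSquare_complexification
    (Nat.eq_of_mul_eq_mul_left (by positivity) h1)

/-- The normal closure is taken over `E`, not over the complexification, because the degree argument
needs an extension that is Galois over `E`. -/
theorem exists_root_complexification (p : (Complexification E)[X]) (hp : Irreducible p) :
    ∃ x, p.eval x = 0 := by
  have := Fact.mk hp
  let K := AdjoinRoot p
  have hK : FiniteDimensional (Complexification E) K :=
    (AdjoinRoot.powerBasis hp.ne_zero).finite
  have : FiniteDimensional E K := Module.Finite.trans (Complexification E) K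
  let N := IntermediateField.normalClosure E K (AlgebraicClosure K)
  let _ : Algebra (Complexification E) N := ((algebraMap K N).comp
    (algebraMap (Complexification E) K)).toAlgebra
  have : IsScalarTower (Complexification E) K N := IsScalarTower.of_algebraMap_eq fun _ => rfl
  have : IsScalarTower E (Complexification E) N := IsScalarTower.of_algebraMap_eq fun x => by
    rw [IsScalarTower.algebraMap_apply E K N]; rfl
  have : IsGalois E N := ⟨⟩
  have h1 := finrank_complexification_eq_one (E := E) N
  have h2 := Module.finrank_mul_finrank (Complexification E) K N
  rw [h1] at h2
  have h3 : Module.finrank (Complexification E) K = 1 := Nat.eq_one_of_mul_eq_one_right h2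
  have h4 : p.natDegree = 1 := by
    rw [← h3, (AdjoinRoot.powerBasis hp.ne_zero).finrank, AdjoinRoot.powerBasis_dim]
  obtain ⟨x, hx⟩ := exists_root_of_degree_eq_one (by
    rw [degree_eq_natDegree hp.ne_zero, h4]; rfl : p.degree = 1)
  exact ⟨x, hx⟩

instance isAlgClosed_complexification : IsAlgClosed (Complexification E) :=
  IsAlgClosed.of_exists_root _ fun p _ hp => exists_root_complexification p hp

/-- A nonconstant polynomial over a real closed field is divisible by a linear polynomial or by
`(X - a) ^ 2 + b ^ 2` with `b ≠ 0`. -/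
theorem exists_dvd (p : E[X]) (hp : p.degree ≠ 0) :
    (∃ a, (X - C a) ∣ p) ∨ ∃ a b : E, b ≠ 0 ∧ ((X - C a) ^ 2 + C (b ^ 2)) ∣ p := by
  obtain ⟨z, hz⟩ := IsAlgClosed.exists_aeval_eq_zero (Complexification E) p hp
  by_cases hb : z.im = 0
  · left
    refine ⟨z.re, dvd_iff_isRoot.2 ?_⟩
    have : z = algebraMap E (Complexification E) z.re := by
      ext <;> simp [hb]
    rw [this, aeval_algebraMap_apply] at hz
    simpa [IsRoot] using hz
  · right
    refine ⟨z.re, z.im, hb, ?_⟩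
    -- `q` has roots `z` and its conjugate. The remainder of `p` modulo `q` is linear over `E` and
    -- vanishes at the non-real `z`, so it is zero.
    set q : E[X] := (X - C z.re) ^ 2 + C (z.im ^ 2) with hq
    have hqm : q.Monic := by
      rw [hq]; monicity!
    have hq2 : q.natDegree = 2 := by
      rw [hq]; compute_degree!
    have hqz : aeval z q = 0 := by
      rw [hq]
      ext <;> simp [sq, QuadraticAlgebra.re_mul, QuadraticAlgebra.im_mul]
    have hr : aeval z (p %ₘ q) = 0 := by
      have := modByMonic_add_div p q
      rw [← this] at hz
      simpa [hqz] using hz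
    have hdeg : (p %ₘ q).natDegree < 2 := by
      rw [← hq2]; exact natDegree_modByMonic_lt p hqm (by intro h; rw [h] at hq2; simp at hq2)
    rw [← modByMonic_eq_zero_iff_dvd hqm]
    rw [eq_X_add_C_of_natDegree_le_one (by omega : (p %ₘ q).natDegree ≤ 1)] at hr ⊢
    have him := congrArg QuadraticAlgebra.im hr
    have hre := congrArg QuadraticAlgebra.re hr
    simp [QuadraticAlgebra.re_mul, QuadraticAlgebra.im_mul, hb] at him hre
    simp [him] at hre
    simp [him, hre]

end IsRealClosed

end

/-! ### Counting real embeddings by the signature of the trace form. -/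

section

open Polynomial

namespace Complexification

variable (K E : Type*) [Field K] [Field E] [LinearOrder E] [IsStrictOrderedRing E] [Algebra K E]

/-- Complex conjugation. -/
def conj : Complexification E →ₐ[K] Complexification E where
  toFun := star
  map_one' := star_one _
  map_mul' := star_mul'
  map_zero' := star_zero _
  map_add' := star_add
  commutes' k := by ext <;> simp [IsScalarTower.algebraMap_apply K E (Complexification E)]

@[simp] theorem conj_re (z : Complexification E) : (conj K E z).re = z.re := by simp [conj]

@[simp] theorem conj_im (z : Complexification E) : (conj K E z).im = -z.im := by simp [conj]

variable {K E} {L : Type*} [Field L] [Algebra K L]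

@[simp] theorem conj_comp_conj_comp (σ : L →ₐ[K] Complexification E) :
    (conj K E).comp ((conj K E).comp σ) = σ := by
  apply AlgHom.ext
  intro x
  apply QuadraticAlgebra.ext <;> simp

/-- Allows embeddings into `E` to be counted among the embeddings into an algebraically closed
field, whose total number is the degree. -/
theorem exists_conj_comp_eq_iff :
    (∃ σ : L →ₐ[K] Complexification E, (conj K E).comp σ = σ) ↔ Nonempty (L →ₐ[K] E) := by
  constructor
  · rintro ⟨σ, hσ⟩
    have him (x : L) : (σ x).im = 0 := by
      have := congrArg QuadraticAlgebra.im (DFunLike.congr_fun hσ x)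
      simp only [AlgHom.comp_apply, conj_im] at this
      linarith
    exact ⟨{ toFun := fun x => (σ x).re
             map_one' := by rw [map_one]; rfl
             map_mul' := fun x y => by simp [QuadraticAlgebra.re_mul, him]
             map_zero' := by simp
             map_add' := fun x y => by simp
             commutes' := fun k => by
              simp [IsScalarTower.algebraMap_apply K E (Complexification E)] }⟩
  · rintro ⟨f⟩
    refine ⟨(IsScalarTower.toAlgHom K E (Complexification E)).comp f, AlgHom.ext fun x => ?_⟩
    apply QuadraticAlgebra.ext <;> simp

end Complexification

open Complexification

/-- In characteristic zero, trace forms of finite extensions can be diagonalized. -/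
theorem exists_basis_trace_mul_eq_zero (K L : Type*) [Field K] [Field L] [CharZero K]
    [Algebra K L] [FiniteDimensional K L] :
    ∃ v : Module.Basis (Fin (Module.finrank K L)) K L,
      (∀ i j, i ≠ j → Algebra.trace K L (v i * v j) = 0) ∧
      ∀ i, Algebra.trace K L (v i * v i) ≠ 0 := by
  have : Invertible (2 : K) := invertibleOfNonzero two_ne_zero
  obtain ⟨v, hv⟩ := LinearMap.BilinForm.exists_orthogonal_basis
    (B := Algebra.traceForm K L) ⟨fun x y => (Algebra.traceForm_isSymm K).eq x y⟩
  refine ⟨v, fun i j hij => by simpa using hv hij, fun i => ?_⟩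
  have h := LinearMap.BilinForm.iIsOrtho.not_isOrtho_basis_self_of_nondegenerate hv
    (traceForm_nondegenerate K L) i
  exact h

namespace IsRealClosed

variable {K L E : Type*} [Field K] [Field L] [Algebra K L]
  [Field E] [LinearOrder E] [IsStrictOrderedRing E] [Algebra K E]

section

variable {ι : Type*} [Fintype ι] (v : ι → L) (c : ι → E)

/-- The value at `∑ c i ⊗ v i` of the extension of `σ` to `E ⊗ L`. -/
noncomputable def evalSum (σ : L →ₐ[K] Complexification E) : Complexification E :=
  ∑ i, algebraMap E (Complexification E) (c i) * σ (v i)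

theorem evalSum_conj (σ : L →ₐ[K] Complexification E) :
    evalSum v c ((conj K E).comp σ) = conj K E (evalSum v c σ) := by
  simp only [evalSum, map_sum, map_mul, AlgHom.comp_apply]
  refine Finset.sum_congr rfl fun i _ => ?_
  congr 1
  apply QuadraticAlgebra.ext <;> simp

/-- The trace is the sum over all embeddings. Hence the trace form, diagonal in `v`, is also the sum
of the squares of the linear forms `evalSum v · σ`. -/
theorem sum_evalSum_sq [FiniteDimensional K L] [IsRealClosed E] [CharZero K]
    (hv : ∀ i j, i ≠ j → Algebra.trace K L (v i * v j) = 0) :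
    ∑ σ : L →ₐ[K] Complexification E, evalSum v c σ ^ 2 =
      algebraMap E _ (∑ i, c i ^ 2 * algebraMap K E (Algebra.trace K L (v i * v i))) := by
  have h (x : L) : ∑ σ : L →ₐ[K] Complexification E, σ x =
      algebraMap E _ (algebraMap K E (Algebra.trace K L x)) := by
    rw [← IsScalarTower.algebraMap_apply, trace_eq_sum_embeddings]
  simp only [evalSum, sq, Finset.sum_mul_sum, map_sum, map_mul]
  rw [Finset.sum_comm]
  refine Finset.sum_congr rfl fun i _ => ?_
  rw [Finset.sum_comm, Finset.sum_eq_single i]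
  · rw [← h, Finset.mul_sum]
    refine Finset.sum_congr rfl fun σ _ => ?_
    rw [map_mul]; ring
  · intro j _ hj
    have := h (v i * v j)
    rw [hv i j hj.symm, map_zero, map_zero] at this
    calc _ = algebraMap E (Complexification E) (c i) * algebraMap E _ (c j) *
          ∑ σ : L →ₐ[K] Complexification E, σ (v i * v j) := by
          rw [Finset.mul_sum]
          refine Finset.sum_congr rfl fun σ _ => ?_
          rw [map_mul]; ring
      _ = 0 := by rw [this, mul_zero]
  · simp

end

/-- Dimension count: with more unknowns than linear conditions there is a nonzero solution. -/
theorem card_le_of_forall_evalSum {ι : Type*} [Fintype ι] {H : Type*} [Fintype H]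
    (σ : H → (L →ₐ[K] Complexification E)) (v : ι → L) (g : Complexification E →ₗ[E] E)
    (h : ∀ c : ι → E, (∀ j, g (evalSum v c (σ j)) = 0) → c = 0) :
    Fintype.card ι ≤ Fintype.card H := by
  by_contra! hlt
  let T : (ι → E) →ₗ[E] (H → E) :=
    LinearMap.pi fun j => g ∘ₗ
      (∑ i, (LinearMap.toSpanSingleton E _ (σ j (v i))) ∘ₗ LinearMap.proj i)
  have hker := LinearMap.ker_ne_bot_of_finrank_lt (f := T) (by simpa using hlt)
  obtain ⟨c, hc, hc0⟩ := (Submodule.ne_bot_iff _).1 hker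
  refine hc0 (h c fun j => ?_)
  have := congrFun (LinearMap.mem_ker.1 hc) j
  simpa [T, evalSum, Algebra.smul_def] using this

/-- Sylvester's theorem: the number of embeddings of `L` into the real closed field `E` is the
signature of the trace form of `L` over `K`. -/
theorem card_pos_eq_card_neg_add [FiniteDimensional K L] [IsRealClosed E] [CharZero K]
    {ι : Type*} [Fintype ι]
    (v : Module.Basis ι K L)
    (hv : ∀ i j, i ≠ j → Algebra.trace K L (v i * v j) = 0)
    (hv0 : ∀ i, Algebra.trace K L (v i * v i) ≠ 0) :
    Nat.card {i // 0 < algebraMap K E (Algebra.trace K L (v i * v i))} =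
      Nat.card {i // algebraMap K E (Algebra.trace K L (v i * v i)) < 0} +
      Nat.card {σ : L →ₐ[K] Complexification E // (conj K E).comp σ = σ} := by
  classical
  set d : ι → E := fun i => algebraMap K E (Algebra.trace K L (v i * v i)) with hd
  have hd0 (i) : d i ≠ 0 := by simpa [hd] using hv0 i
  -- The numbering picks one member of each conjugate pair, namely the `σ` with `e σ < e (τ σ)`.
  -- Equality singles out the real embeddings.
  let e := Fintype.equivFin (L →ₐ[K] Complexification E)
  let τ : (L →ₐ[K] Complexification E) → (L →ₐ[K] Complexification E) := fun σ => (conj K E).comp σ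
  have hττ (σ) : τ (τ σ) = σ := conj_comp_conj_comp σ
  -- If the imaginary parts vanish on one member of each pair, all values are real and the form is
  -- nonnegative; on the negative part of the basis this forces `c = 0`.
  have hneg : Fintype.card {i // d i < 0} ≤ Fintype.card {σ // e σ < e (τ σ)} := by
    refine card_le_of_forall_evalSum (K := K) (L := L) (E := E) Subtype.val (fun i => v i.1)
      (QuadraticAlgebra.imₗ (-1 : E) 0) fun c hc => ?_
    have him (σ : L →ₐ[K] Complexification E) :
        (evalSum (fun i : {i // d i < 0} => v i.1) c σ).im = 0 := by
      rcases lt_trichotomy (e σ) (e (τ σ)) with h | h | h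
      · exact hc ⟨σ, h⟩
      · have := congrArg QuadraticAlgebra.im
          (evalSum_conj (fun i : {i // d i < 0} => v i.1) c σ)
        rw [show (conj K E).comp σ = σ from (e.injective h).symm, conj_im] at this
        linarith
      · have := hc ⟨τ σ, by rwa [hττ]⟩
        simpa [τ, evalSum_conj] using this
    have hs := congrArg QuadraticAlgebra.re (sum_evalSum_sq (K := K) (L := L)
      (fun i : {i // d i < 0} => v i.1) c fun i j hij => hv _ _ fun h => hij (Subtype.ext h))
    have hre : 0 ≤ QuadraticAlgebra.re (∑ σ : L →ₐ[K] Complexification E,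
        evalSum (fun i : {i // d i < 0} => v i.1) c σ ^ 2) := by
      rw [← QuadraticAlgebra.reₗ_apply, map_sum]
      refine Finset.sum_nonneg fun σ _ => ?_
      simp only [QuadraticAlgebra.reₗ_apply, sq, QuadraticAlgebra.re_mul, him]
      nlinarith [sq_nonneg (evalSum (fun i : {i // d i < 0} => v i.1) c σ).re]
    rw [hs, QuadraticAlgebra.algebraMap_re] at hre
    have hz := (Finset.sum_eq_zero_iff_of_nonpos (fun i _ =>
      mul_nonpos_of_nonneg_of_nonpos (sq_nonneg (c i)) i.2.le)).1
      (le_antisymm (Finset.sum_nonpos fun i _ =>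
        mul_nonpos_of_nonneg_of_nonpos (sq_nonneg (c i)) i.2.le) hre)
    funext i
    simpa [hd0] using hz i (Finset.mem_univ i)
  -- The same with real parts: purely imaginary values make the form nonpositive. Here the real
  -- embeddings also impose conditions.
  have hpos : Fintype.card {i // 0 < d i} ≤ Fintype.card {σ // e σ ≤ e (τ σ)} := by
    refine card_le_of_forall_evalSum (K := K) (L := L) (E := E) Subtype.val (fun i => v i.1)
      (QuadraticAlgebra.reₗ (-1 : E) 0) fun c hc => ?_
    have him (σ : L →ₐ[K] Complexification E) :
        (evalSum (fun i : {i // 0 < d i} => v i.1) c σ).re = 0 := by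
      rcases le_or_gt (e σ) (e (τ σ)) with h | h
      · exact hc ⟨σ, h⟩
      · have := hc ⟨τ σ, by rw [hττ]; exact h.le⟩
        simpa [τ, evalSum_conj] using this
    have hs := congrArg QuadraticAlgebra.re (sum_evalSum_sq (K := K) (L := L)
      (fun i : {i // 0 < d i} => v i.1) c fun i j hij => hv _ _ fun h => hij (Subtype.ext h))
    have hre : QuadraticAlgebra.re (∑ σ : L →ₐ[K] Complexification E,
        evalSum (fun i : {i // 0 < d i} => v i.1) c σ ^ 2) ≤ 0 := by
      rw [← QuadraticAlgebra.reₗ_apply, map_sum]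
      refine Finset.sum_nonpos fun σ _ => ?_
      simp only [QuadraticAlgebra.reₗ_apply, sq, QuadraticAlgebra.re_mul, him]
      nlinarith [sq_nonneg (evalSum (fun i : {i // 0 < d i} => v i.1) c σ).im]
    rw [hs, QuadraticAlgebra.algebraMap_re] at hre
    have hz := (Finset.sum_eq_zero_iff_of_nonneg (fun i _ =>
      mul_nonneg (sq_nonneg (c i)) i.2.le)).1
      (le_antisymm hre (Finset.sum_nonneg fun i _ => mul_nonneg (sq_nonneg (c i)) i.2.le))
    funext i
    simpa [hd0] using hz i (Finset.mem_univ i)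
  have hgt : Fintype.card {σ // e σ < e (τ σ)} = Fintype.card {σ // ¬ e σ ≤ e (τ σ)} := by
    refine Fintype.card_congr ((Equiv.mk τ τ hττ hττ).subtypeEquiv fun σ => ?_)
    simp [hττ]
  have hle : Fintype.card {σ // e σ ≤ e (τ σ)} =
      Fintype.card {σ // e σ < e (τ σ)} +
        Fintype.card {σ : L →ₐ[K] Complexification E // (conj K E).comp σ = σ} := by
    rw [← Fintype.card_subtype_or_disjoint]
    · refine Fintype.card_congr (Equiv.subtypeEquivRight fun σ => ?_)
      rw [le_iff_lt_or_eq, e.injective.eq_iff, eq_comm (a := σ)]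
    · rw [Pi.disjoint_iff]
      intro σ
      simp only [Prop.disjoint_iff]
      rintro ⟨h1, h2⟩
      rw [show τ σ = σ from h2] at h1
      exact lt_irrefl _ h1
  -- With `p` pairs and `r` real embeddings, `neg ≤ p`, `pos ≤ p + r` and `pos + neg = 2p + r`, so
  -- both bounds are equalities.
  have htot : Fintype.card {σ // e σ ≤ e (τ σ)} + Fintype.card {σ // ¬ e σ ≤ e (τ σ)} =
      Fintype.card ι := by
    rw [Fintype.card_subtype_compl, Nat.add_sub_cancel' (Fintype.card_subtype_le _),
      AlgHom.card K L (Complexification E), Module.finrank_eq_card_basis v]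
  have htot' : Fintype.card {i // 0 < d i} + Fintype.card {i // d i < 0} = Fintype.card ι := by
    have : Fintype.card {i // d i < 0} = Fintype.card {i // ¬ 0 < d i} :=
      Fintype.card_congr (Equiv.subtypeEquivRight fun i => by
        rw [not_lt, le_iff_lt_or_eq, or_iff_left (hd0 i)])
    rw [this, Fintype.card_subtype_compl, Nat.add_sub_cancel' (Fintype.card_subtype_le _)]
  change Nat.card {i // 0 < d i} = Nat.card {i // d i < 0} + _
  simp only [← Nat.card_eq_fintype_card] at hneg hpos hgt hle htot htot'
  omega

end IsRealClosed

/-! ### Embedding algebraic real closed extensions compatibly with orderings. -/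

namespace IsRealClosed

variable {K S M : Type*} [Field K]
  [Field S] [LinearOrder S] [IsStrictOrderedRing S] [IsRealClosed S] [Algebra K S]
  [Field M] [LinearOrder M] [IsStrictOrderedRing M] [IsRealClosed M] [Algebra K M]

/-- A finite extension of `K` that embeds into a real closed extension of `K` embeds into every
real closed extension that induces the same ordering on `K`. -/
theorem nonempty_algHom_of_finiteDimensional {L : Type*} [Field L] [Algebra K L]
    [FiniteDimensional K L]
    (h : ∀ k : K, 0 < algebraMap K S k → 0 < algebraMap K M k) (f : L →ₐ[K] S) :
    Nonempty (L →ₐ[K] M) := by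
  have : CharZero K := (algebraMap K S).charZero
  obtain ⟨v, hv, hv0⟩ := exists_basis_trace_mul_eq_zero K L
  have h' (k : K) : algebraMap K S k < 0 → algebraMap K M k < 0 := by
    simpa using h (-k)
  have h1 := card_pos_eq_card_neg_add (E := S) v hv hv0
  have h2 := card_pos_eq_card_neg_add (E := M) v hv hv0
  -- The diagonal entries lie in `K`, so passing from `S` to `M` cannot lower `pos` or raise `neg`;
  -- the number of real embeddings stays positive.
  have hp : Nat.card {i // 0 < algebraMap K S (Algebra.trace K L (v i * v i))} ≤
      Nat.card {i // 0 < algebraMap K M (Algebra.trace K L (v i * v i))} :=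
    Nat.card_le_card_of_injective (Subtype.map id fun i => h _)
      (Subtype.map_injective _ Function.injective_id)
  have hn : Nat.card {i // algebraMap K M (Algebra.trace K L (v i * v i)) < 0} ≤
      Nat.card {i // algebraMap K S (Algebra.trace K L (v i * v i)) < 0} :=
    Nat.card_le_card_of_injective (Subtype.map id fun i hi => by
        rcases lt_trichotomy 0 (algebraMap K S (Algebra.trace K L (v i * v i))) with h3 | h3 | h3
        · exact absurd (h _ h3) hi.not_gt
        · rw [eq_comm, map_eq_zero] at h3
          simp [h3] at hi
        · exact h3)
      (Subtype.map_injective _ Function.injective_id)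
  obtain ⟨σ, hσ⟩ := exists_conj_comp_eq_iff.2 ⟨f⟩
  have : Nonempty {σ : L →ₐ[K] Complexification S // (conj K S).comp σ = σ} := ⟨⟨σ, hσ⟩⟩
  have hpos : 0 < Nat.card {σ : L →ₐ[K] Complexification S // (conj K S).comp σ = σ} :=
    Nat.card_pos
  have hpos' : 0 < Nat.card {σ : L →ₐ[K] Complexification M // (conj K M).comp σ = σ} := by
    omega
  obtain ⟨σ', hσ'⟩ := (Nat.card_pos_iff.1 hpos').1
  exact exists_conj_comp_eq_iff.1 ⟨σ', hσ'⟩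

/-- A real closed field algebraic over `K` embeds over `K` into every real closed extension that
induces the same ordering on `K`. -/
theorem nonempty_algHom_of_isAlgebraic [Algebra.IsAlgebraic K S]
    (h : ∀ k : K, 0 < algebraMap K S k → 0 < algebraMap K M k) : Nonempty (S →ₐ[K] M) := by
  -- It suffices to find in `M` a root of the minimal polynomial of each single element.
  refine Field.nonempty_algHom_of_exists_root fun x => ?_
  have hx : IsIntegral K x := Algebra.IsIntegral.isIntegral x
  have := IntermediateField.adjoin.finiteDimensional hx
  obtain ⟨g⟩ := nonempty_algHom_of_finiteDimensional (L := IntermediateField.adjoin K {x}) h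
    (IntermediateField.val _)
  refine ⟨g (IntermediateField.AdjoinSimple.gen K x), ?_⟩
  rw [aeval_algHom_apply, ← IntermediateField.minpoly_gen K x, minpoly.aeval, map_zero]

end IsRealClosed

end

/-! ### Existence of real closures, through preorderings. -/

section

open Polynomial

/-- A polynomial of odd degree over a field has an irreducible factor of odd degree. -/
theorem Polynomial.exists_irreducible_odd_natDegree_dvd {K : Type*} [Field K] (f : K[X])
    (hf : Odd f.natDegree) : ∃ q, Irreducible q ∧ Odd q.natDegree ∧ q ∣ f := by
  induction f using WfDvdMonoid.induction_on_irreducible with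
  | zero => simp at hf
  | unit u hu => simp [natDegree_eq_zero_of_isUnit hu] at hf
  | mul a i ha hi ih =>
    rw [natDegree_mul hi.ne_zero ha, Nat.odd_add] at hf
    by_cases ho : Odd i.natDegree
    · exact ⟨i, hi, ho, dvd_mul_right _ _⟩
    · obtain ⟨q, hq, hq', hqa⟩ := ih (by
        rw [← Nat.not_even_iff_odd]; exact fun h => ho (hf.2 h))
      exact ⟨q, hq, hq', hqa.mul_left i⟩

namespace RingPreordering

variable {K : Type*} [Field K] (T : RingPreordering K)

/-- The polynomials `∑ t * g ^ 2` with `t ∈ T` and `g` of degree `< n`. -/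
noncomputable def polynomialSums (n : ℕ) : AddSubmonoid K[X] :=
  AddSubmonoid.closure {s | ∃ t ∈ T, ∃ g : K[X], g.degree < n ∧ s = C t * g ^ 2}

theorem polynomialSums_mono {m n : ℕ} (h : m ≤ n) : T.polynomialSums m ≤ T.polynomialSums n :=
  AddSubmonoid.closure_mono fun _ ⟨t, ht, g, hg, hs⟩ =>
    ⟨t, ht, g, hg.trans_le (by exact_mod_cast h), hs⟩

variable {T}

theorem add_ne_zero {a b : K} (ha : a ∈ T) (hb : b ∈ T) (ha0 : a ≠ 0) : a + b ≠ 0 := by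
  intro h
  exact ha0 (RingPreordering.eq_zero_of_mem_of_neg_mem (P := T) ha
    (by rwa [neg_eq_of_add_eq_zero_right h]))

/-- Leading terms cannot cancel, because a preordering of a field meets its negative only in zero.
-/
theorem leadingCoeff_mem_and_even_natDegree {n : ℕ} {s : K[X]} (hs : s ∈ T.polynomialSums n) :
    s.leadingCoeff ∈ T ∧ Even s.natDegree ∧ s.natDegree ≤ 2 * (n - 1) := by
  induction hs using AddSubmonoid.closure_induction with
  | zero => simp
  | mem s hs =>
    obtain ⟨t, ht, g, hg, rfl⟩ := hs
    refine ⟨?_, ?_, ?_⟩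
    · rw [leadingCoeff_mul, leadingCoeff_C, leadingCoeff_pow]
      exact mul_mem ht (T.pow_two_mem _)
    · by_cases h0 : t = 0
      · simp [h0]
      · rw [natDegree_C_mul h0, natDegree_pow]
        exact even_two_mul _
    · refine (natDegree_C_mul_le _ _).trans ?_
      rw [natDegree_pow]
      by_cases h0 : g = 0
      · simp [h0]
      · rw [degree_eq_natDegree h0] at hg
        have : g.natDegree < n := by exact_mod_cast hg
        omega
  | add a b _ _ ha hb =>
    by_cases ha0 : a = 0
    · simpa [ha0] using hb
    by_cases hb0 : b = 0
    · simpa [hb0] using ha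
    rcases lt_trichotomy a.natDegree b.natDegree with h | h | h
    · rw [leadingCoeff_add_of_degree_lt (degree_lt_degree h),
        natDegree_add_eq_right_of_natDegree_lt h]
      exact hb
    · have hne := add_ne_zero ha.1 hb.1 (leadingCoeff_ne_zero.2 ha0)
      have hdeg : (a + b).natDegree = a.natDegree := by
        apply le_antisymm
        · exact (natDegree_add_le _ _).trans (by rw [h, max_self])
        · apply le_natDegree_of_ne_zero
          rw [coeff_add]; nth_rewrite 2 [h]; exact hne
      rw [hdeg]
      refine ⟨?_, ha.2⟩
      rw [leadingCoeff, hdeg, coeff_add]; nth_rewrite 2 [h]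
      exact add_mem ha.1 hb.1
    · rw [leadingCoeff_add_of_degree_lt' (degree_lt_degree h),
        natDegree_add_eq_left_of_natDegree_lt h]
      exact ha

/-- Reducing each `g` modulo `q` bounds the degrees, which drives the descent on odd degrees. -/
theorem exists_mem_polynomialSums_dvd_sub {n : ℕ} {s q : K[X]} (hs : s ∈ T.polynomialSums n)
    (hq : q ≠ 0) : ∃ s' ∈ T.polynomialSums q.natDegree, q ∣ s - s' := by
  induction hs using AddSubmonoid.closure_induction with
  | zero => exact ⟨0, zero_mem _, by simp⟩
  | mem s hs =>
    obtain ⟨t, ht, g, hg, rfl⟩ := hs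
    refine ⟨C t * (g % q) ^ 2, AddSubmonoid.subset_closure ⟨t, ht, g % q, ?_, rfl⟩, ?_⟩
    · rw [← degree_eq_natDegree hq]; exact degree_mod_lt _ hq
    · have h := EuclideanDomain.div_add_mod g q
      have : q ∣ g - g % q := ⟨g / q, by linear_combination -h⟩
      rw [← mul_sub]
      exact (this.trans (sub_dvd_pow_sub_pow _ _ 2)).mul_left _
  | add a b _ _ ha hb =>
    obtain ⟨a', ha', hqa⟩ := ha
    obtain ⟨b', hb', hqb⟩ := hb
    exact ⟨a' + b', add_mem ha' hb', by rw [add_sub_add_comm]; exact dvd_add hqa hqb⟩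

/-- Orderings extend to extensions of odd degree. -/
theorem not_dvd_one_add_of_odd {n : ℕ} {s q : K[X]} (hq : Odd q.natDegree)
    (hs : s ∈ T.polynomialSums n) : ¬ q ∣ 1 + s := by
  induction hm : q.natDegree using Nat.strong_induction_on generalizing n s q with
  | h m ih =>
    intro hdvd
    have hq0 : q ≠ 0 := by rintro rfl; simp at hq
    obtain ⟨s', hs', hss'⟩ := exists_mem_polynomialSums_dvd_sub hs hq0
    have hdvd' : q ∣ 1 + s' := by
      have := dvd_sub hdvd hss'
      rwa [show 1 + s - (s - s') = 1 + s' by ring] at this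
    have h1 : (1 : K[X]) ∈ T.polynomialSums q.natDegree :=
      AddSubmonoid.subset_closure ⟨1, one_mem _, 1, by
        rw [degree_one]; exact_mod_cast hq.pos, by simp⟩
    obtain ⟨hl, he, hd⟩ := leadingCoeff_mem_and_even_natDegree (add_mem h1 hs')
    have hne : 1 + s' ≠ 0 := by
      intro h
      have hs1 : s' = -1 := by linear_combination h
      have := (leadingCoeff_mem_and_even_natDegree hs').1
      rw [hs1, leadingCoeff_neg, leadingCoeff_one] at this
      exact T.neg_one_notMem this
    obtain ⟨h, hh⟩ := hdvd'
    have hh0 : h ≠ 0 := by rintro rfl; simp [hh] at hne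
    have hdeg : (1 + s').natDegree = q.natDegree + h.natDegree := by
      rw [hh, natDegree_mul hq0 hh0]
    rw [hdeg] at he hd
    -- The product has even degree at most `2 (deg q - 1)`, so the cofactor `h` has odd degree
    -- smaller than that of `q` and divides the same `1 + s'`.
    have hho : Odd h.natDegree := by
      rw [Nat.even_add'] at he; exact he.1 hq
    exact ih h.natDegree (by have := hq.pos; omega) hho hs' rfl (Dvd.intro_left q hh.symm)

/-- If the ordering does not extend to `K(√x)` then `x` is negative. -/
theorem neg_mem_of_dvd_one_add {n : ℕ} {s : K[X]} {x : K} (hs : s ∈ T.polynomialSums n)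
    (hdvd : X ^ 2 - C x ∣ 1 + s) : -x ∈ T := by
  -- Modulo `X ^ 2 - x`, the term `t (u + v X) ^ 2` becomes `t u ^ 2 + x t v ^ 2 + 2 t u v X`.
  have key : ∃ a ∈ T, ∃ b ∈ T, ∃ c : K, X ^ 2 - C x ∣ s - (C (a + x * b) + C c * X) := by
    clear hdvd
    have hm : (X ^ 2 - C x).natDegree = 2 := natDegree_X_pow_sub_C
    obtain ⟨s', hs', hss'⟩ := exists_mem_polynomialSums_dvd_sub hs
      (ne_zero_of_natDegree_gt (n := 1) (by rw [hm]; exact one_lt_two) : X ^ 2 - C x ≠ 0)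
    rw [hm] at hs'
    suffices h : ∃ a ∈ T, ∃ b ∈ T, ∃ c : K, X ^ 2 - C x ∣ s' - (C (a + x * b) + C c * X) by
      obtain ⟨a, ha, b, hb, c, h⟩ := h
      exact ⟨a, ha, b, hb, c, by simpa using dvd_add hss' h⟩
    clear hss'
    induction hs' using AddSubmonoid.closure_induction with
    | zero => exact ⟨0, zero_mem _, 0, zero_mem _, 0, by simp⟩
    | mem s hs =>
      obtain ⟨t, ht, g, hg, rfl⟩ := hs
      have hg' : g.natDegree ≤ 1 := natDegree_le_of_degree_le (Order.le_of_lt_succ hg)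
      rw [eq_X_add_C_of_natDegree_le_one hg']
      refine ⟨t * g.coeff 0 ^ 2, mul_mem ht (T.pow_two_mem _), t * g.coeff 1 ^ 2,
        mul_mem ht (T.pow_two_mem _), 2 * t * g.coeff 0 * g.coeff 1,
        ⟨C (t * g.coeff 1 ^ 2), ?_⟩⟩
      simp only [map_mul, map_add, map_pow, map_ofNat]
      ring
    | add p q _ _ hp hq =>
      obtain ⟨a, ha, b, hb, c, h⟩ := hp
      obtain ⟨a', ha', b', hb', c', h'⟩ := hq
      refine ⟨a + a', add_mem ha ha', b + b', add_mem hb hb', c + c', ?_⟩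
      convert dvd_add h h' using 1
      simp only [map_mul, map_add]
      ring
  obtain ⟨a, ha, b, hb, c, h⟩ := key
  have h2 := dvd_sub hdvd h
  have h3 : 1 + s - (s - (C (a + x * b) + C c * X)) = C c * X + C (1 + (a + x * b)) := by
    simp only [map_add, map_one]; ring
  rw [h3] at h2
  have h4 : C c * X + C (1 + (a + x * b)) = 0 := by
    refine eq_zero_of_dvd_of_degree_lt h2 ?_
    rw [degree_X_pow_sub_C two_pos]
    exact lt_of_le_of_lt degree_linear_le (by norm_num)
  have h5 : 1 + a + x * b = 0 := by
    have := congrArg (coeff · 0) h4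
    simp at this
    linear_combination this
  have hb0 : b ≠ 0 := by
    rintro rfl
    have ha1 : a = -1 := by linear_combination h5
    exact T.neg_one_notMem (ha1 ▸ ha)
  have : -x = (1 + a) * b * (b⁻¹) ^ 2 := by
    field_simp
    linear_combination -h5
  rw [this]
  exact mul_mem (mul_mem (add_mem (one_mem _) ha) hb) (T.pow_two_mem _)

end RingPreordering

namespace IsRealClosed

/-- Otherwise `-(a ^ 2 + b ^ 2)` is a square, and dividing by `a ^ 2` writes `-1` as a sum of
squares. -/
theorem exists_add_eq_sq {K : Type*} [Field K] [IsRealClosed K] (a b : K) :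
    IsSquare (a ^ 2 + b ^ 2) := by
  rcases isSquare_or_isSquare_neg (a ^ 2 + b ^ 2) with h | ⟨c, hc⟩
  · exact h
  by_cases ha : a = 0
  · exact ⟨b, by rw [ha]; ring⟩
  · have hs : IsSumSq ((b / a) * (b / a) + (c / a) * (c / a)) :=
      (IsSumSq.mul_self _).add (IsSumSq.mul_self _)
    exact absurd (by field_simp; linear_combination -hc) (IsSemireal.one_add_ne_zero hs)

/-- The squares of a real closed field as a positive cone. -/
def squareCone (K : Type*) [Field K] [IsRealClosed K] : RingCone K where
  carrier := {x | IsSquare x}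
  zero_mem' := IsSquare.zero
  one_mem' := IsSquare.one
  mul_mem' ha hb := ha.mul hb
  add_mem' := by
    rintro _ _ ⟨a, rfl⟩ ⟨b, rfl⟩
    simpa only [← sq] using! exists_add_eq_sq a b
  eq_zero_of_mem_of_neg_mem' := by
    rintro _ ⟨a, rfl⟩ ⟨b, hb⟩
    by_contra h
    have ha : a ≠ 0 := by rintro rfl; simp at h
    exact absurd (by field_simp; linear_combination -hb)
      (IsSemireal.one_add_ne_zero (IsSumSq.mul_self (b / a)))

instance (K : Type*) [Field K] [IsRealClosed K] : HasMemOrNegMem (squareCone K) :=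
  ⟨isSquare_or_isSquare_neg⟩

open Classical in
/-- The unique ordering of a real closed field. -/
@[reducible] noncomputable def linearOrder (K : Type*) [Field K] [IsRealClosed K] : LinearOrder K :=
  LinearOrder.mkOfAddGroupCone (squareCone K)

theorem isStrictOrderedRing_linearOrder (K : Type*) [Field K] [IsRealClosed K] :
    letI := linearOrder K
    IsStrictOrderedRing K := by
  let _ := linearOrder K
  have := IsOrderedRing.mkOfCone (squareCone K)
  exact IsOrderedRing.toIsStrictOrderedRing K

end IsRealClosed

namespace RealClosure

variable (F : Type*) [Field F] [LinearOrder F] [IsStrictOrderedRing F]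
variable {Ω : Type*} [Field Ω] [Algebra F Ω]

/-- The elements `p * y ^ 2` with `p` a nonnegative element of `F` and `y ∈ K`. -/
def weightedSquares (K : IntermediateField F Ω) : Submonoid Ω where
  carrier := {z | ∃ p : F, 0 ≤ p ∧ ∃ y ∈ K, z = algebraMap F Ω p * y ^ 2}
  one_mem' := ⟨1, zero_le_one, 1, one_mem _, by simp⟩
  mul_mem' := by
    rintro _ _ ⟨p, hp, y, hy, rfl⟩ ⟨q, hq, z, hz, rfl⟩
    exact ⟨p * q, mul_nonneg hp hq, y * z, mul_mem hy hz, by rw [map_mul]; ring⟩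

variable {F}

theorem weightedSquares_mono {K L : IntermediateField F Ω} (h : K ≤ L) :
    weightedSquares F K ≤ weightedSquares F L :=
  fun _ ⟨p, hp, y, hy, hz⟩ => ⟨p, hp, y, h hy, hz⟩

/-- The preordering of `K` generated by the nonnegative elements of `F`. -/
def preordering (K : IntermediateField F Ω)
    (hK : (-1 : Ω) ∉ (weightedSquares F K).subsemiringClosure) : RingPreordering K where
  toSubsemiring := (weightedSquares F K).subsemiringClosure.comap K.val.toRingHom
  mem_of_isSquare' := by
    rintro _ ⟨y, rfl⟩
    exact AddSubmonoid.subset_closure ⟨1, zero_le_one, y, y.2, by simp [sq]⟩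
  neg_one_notMem' := fun h => hK (by simpa using h)

/-- Zorn's lemma: a representation of `-1` uses finitely many elements, so in a union of a chain it
already occurs in one member. -/
theorem exists_maximal (h0 : (-1 : Ω) ∉
      (weightedSquares F (⊥ : IntermediateField F Ω)).subsemiringClosure) :
    ∃ K : IntermediateField F Ω,
      Maximal (fun K => (-1 : Ω) ∉ (weightedSquares F K).subsemiringClosure) K := by
  suffices h : ∀ c ⊆ {K : IntermediateField F Ω |
      (-1 : Ω) ∉ (weightedSquares F K).subsemiringClosure}, IsChain (· ≤ ·) c → ∀ y ∈ c,
      ∃ ub ∈ {K : IntermediateField F Ω |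
        (-1 : Ω) ∉ (weightedSquares F K).subsemiringClosure}, ∀ z ∈ c, z ≤ ub by
    obtain ⟨K, -, hK⟩ := zorn_le_nonempty₀ _ h ⊥ h0
    exact ⟨K, hK⟩
  intro c hc hchain y hy
  refine ⟨sSup c, ?_, fun z hz => le_sSup hz⟩
  have hne : Nonempty c := ⟨⟨y, hy⟩⟩
  have hdir : Directed (· ≤ ·) (Subtype.val : c → IntermediateField F Ω) :=
    hchain.directedOn.directed_val
  have key : ∀ z ∈ (weightedSquares F (sSup c)).subsemiringClosure,
      ∃ K ∈ c, z ∈ (weightedSquares F K).subsemiringClosure := by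
    intro z hz
    simp only [Submonoid.subsemiringClosure_mem] at hz ⊢
    induction hz using AddSubmonoid.closure_induction with
    | zero => exact ⟨y, hy, zero_mem _⟩
    | mem z hz =>
      obtain ⟨p, hp, w, hw, rfl⟩ := hz
      rw [sSup_eq_iSup', ← SetLike.mem_coe, IntermediateField.coe_iSup_of_directed hdir,
        Set.mem_iUnion] at hw
      obtain ⟨K, hK⟩ := hw
      exact ⟨K, K.2, AddSubmonoid.subset_closure ⟨p, hp, w, hK, rfl⟩⟩
    | add a b _ _ ha hb =>
      obtain ⟨K, hK, ha⟩ := ha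
      obtain ⟨L, hL, hb⟩ := hb
      rcases hchain.total hK hL with h | h
      · exact ⟨L, hL, add_mem (AddSubmonoid.closure_mono (weightedSquares_mono h) ha) hb⟩
      · exact ⟨K, hK, add_mem ha (AddSubmonoid.closure_mono (weightedSquares_mono h) hb)⟩
  intro hmem
  obtain ⟨K, hK, h⟩ := key _ hmem
  exact hc hK h

theorem exists_mem_polynomialSums {K : IntermediateField F Ω}
    (hK : (-1 : Ω) ∉ (weightedSquares F K).subsemiringClosure) {r : Ω} (hr : IsIntegral K r)
    {z : Ω} (hz : z ∈ (weightedSquares F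
      ((IntermediateField.adjoin K {r}).restrictScalars F)).subsemiringClosure) :
    ∃ n, ∃ s ∈ (preordering K hK).polynomialSums n, aeval r s = z := by
  rw [Submonoid.subsemiringClosure_mem] at hz
  induction hz using AddSubmonoid.closure_induction with
  | zero => exact ⟨0, 0, zero_mem _, map_zero _⟩
  | mem z hz =>
    obtain ⟨p, hp, y, hy, rfl⟩ := hz
    rw [IntermediateField.mem_restrictScalars, ← IntermediateField.mem_toSubalgebra,
      IntermediateField.adjoin_simple_toSubalgebra_of_isAlgebraic hr.isAlgebraic,
      Algebra.adjoin_singleton_eq_range_aeval] at hy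
    obtain ⟨g, rfl⟩ := hy
    refine ⟨g.natDegree + 1, C (algebraMap F K p) * g ^ 2,
      AddSubmonoid.subset_closure ⟨_, ?_, g, ?_, rfl⟩, ?_⟩
    · exact AddSubmonoid.subset_closure ⟨p, hp, 1, one_mem _, by simp⟩
    · exact lt_of_le_of_lt degree_le_natDegree (by exact_mod_cast Nat.lt_succ_self _)
    · simp [← IsScalarTower.algebraMap_apply]
  | add a b _ _ ha hb =>
    obtain ⟨m, s, hs, rfl⟩ := ha
    obtain ⟨n, t, ht, rfl⟩ := hb
    exact ⟨max m n, s + t, add_mem (RingPreordering.polynomialSums_mono _ (le_max_left _ _) hs)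
      (RingPreordering.polynomialSums_mono _ (le_max_right _ _) ht), map_add _ _ _⟩

/-- If `r ∉ K`, maximality makes `-1` a weighted sum of squares in `K(r)`. Lifting it to polynomials
in `r` shows that the minimal polynomial divides some `1 + s`. -/
theorem mem_of_maximal {K : IntermediateField F Ω}
    (hK : Maximal (fun K => (-1 : Ω) ∉ (weightedSquares F K).subsemiringClosure) K)
    {r : Ω} (hr : IsIntegral K r)
    (h : ∀ n, ∀ s ∈ (preordering K hK.prop).polynomialSums n, ¬ minpoly K r ∣ 1 + s) :
    r ∈ K := by
  have hle : K ≤ (IntermediateField.adjoin K {r}).restrictScalars F := fun x hx =>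
    (IntermediateField.adjoin K {r}).algebraMap_mem ⟨x, hx⟩
  refine hK.le_of_ge ?_ hle (IntermediateField.mem_adjoin_simple_self K r)
  intro hmem
  obtain ⟨n, s, hs, hsr⟩ := exists_mem_polynomialSums hK.prop hr hmem
  exact h n s hs (minpoly.dvd K r (by simp [hsr]))

variable [IsAlgClosed Ω]

theorem isSquare_of_maximal {K : IntermediateField F Ω}
    (hK : Maximal (fun K => (-1 : Ω) ∉ (weightedSquares F K).subsemiringClosure) K)
    {x : K} (hx : -x ∉ preordering K hK.prop) : IsSquare x := by
  obtain ⟨r, hr⟩ := IsAlgClosed.exists_pow_nat_eq (x : Ω) two_pos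
  have hr' : aeval r (X ^ 2 - C x : K[X]) = 0 := by simp [hr]
  have hmon : (X ^ 2 - C x : K[X]).Monic := monic_X_pow_sub_C x two_ne_zero
  have hint : IsIntegral K r := ⟨_, hmon, hr'⟩
  by_cases hrK : r ∈ K
  · exact ⟨⟨r, hrK⟩, Subtype.ext (by simp [← sq, hr])⟩
  refine absurd (mem_of_maximal hK hint fun n s hs hdvd => ?_) hrK
  have h2 : 2 ≤ (minpoly K r).natDegree := by
    rw [minpoly.two_le_natDegree_iff hint]
    rintro ⟨y, rfl⟩
    exact hrK y.2
  have heq : minpoly K r = X ^ 2 - C x :=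
    (eq_of_monic_of_dvd_of_natDegree_le (minpoly.monic hint) hmon (minpoly.dvd K r hr')
      (by rwa [natDegree_X_pow_sub_C])).symm
  rw [heq] at hdvd
  exact hx (RingPreordering.neg_mem_of_dvd_one_add hs hdvd)

theorem isRealClosed_of_maximal {K : IntermediateField F Ω}
    (hK : Maximal (fun K => (-1 : Ω) ∉ (weightedSquares F K).subsemiringClosure) K) :
    IsRealClosed K where
  one_add_ne_zero {s} hs h := by
    have h1 := RingPreordering.mem_of_isSumSq (P := preordering K hK.prop) hs
    rw [show s = -1 by linear_combination h] at h1
    exact RingPreordering.neg_one_notMem _ h1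
  isSquare_or_isSquare_neg x := by
    by_cases h : -x ∈ preordering K hK.prop
    · by_cases h' : x ∈ preordering K hK.prop
      · left
        rw [RingPreordering.eq_zero_of_mem_of_neg_mem h' h]
        exact IsSquare.zero
      · right
        exact isSquare_of_maximal hK (by rwa [neg_neg])
    · exact .inl (isSquare_of_maximal hK h)
  exists_isRoot_of_odd_natDegree {f} hf := by
    obtain ⟨q, hq, hqo, hqf⟩ := exists_irreducible_odd_natDegree_dvd f hf
    obtain ⟨r, hr⟩ := IsAlgClosed.exists_aeval_eq_zero Ω q
      (degree_pos_of_irreducible hq).ne'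
    have hint : IsIntegral K r := IsAlgebraic.isIntegral ⟨q, hq.ne_zero, hr⟩
    have hass : (minpoly K r).natDegree = q.natDegree := by
      rw [← minpoly.eq_of_irreducible hq hr]
      exact natDegree_mul_C (inv_ne_zero (leadingCoeff_ne_zero.2 hq.ne_zero))
    have hrK := mem_of_maximal hK hint fun n s hs =>
      RingPreordering.not_dvd_one_add_of_odd (hass ▸ hqo) hs
    refine ⟨⟨r, hrK⟩, ?_⟩
    refine IsRoot.dvd (p := q) ?_ hqf
    have h2 : algebraMap K Ω (q.eval ⟨r, hrK⟩) = 0 := by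
      rw [← hr]
      exact (aeval_algebraMap_apply Ω (⟨r, hrK⟩ : K) q).symm
    exact (map_eq_zero _).1 h2

end RealClosure

/-- Every ordered field has a real closed algebraic extension inducing its ordering. -/
theorem exists_realClosure (F : Type*) [Field F] [LinearOrder F] [IsStrictOrderedRing F] :
    ∃ K : IntermediateField F (AlgebraicClosure F), IsRealClosed K ∧
      ∀ x : F, 0 ≤ x → IsSquare (algebraMap F K x) := by
  have h0 : (-1 : AlgebraicClosure F) ∉ (RealClosure.weightedSquares F
      (⊥ : IntermediateField F (AlgebraicClosure F))).subsemiringClosure := by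
    -- Over the bottom field the weighted sums of squares are just nonnegative elements of `F`, so
    -- Zorn's lemma can start there.
    have key : ∀ z ∈ (RealClosure.weightedSquares F
        (⊥ : IntermediateField F (AlgebraicClosure F))).subsemiringClosure,
        ∃ p : F, 0 ≤ p ∧ algebraMap F _ p = z := by
      intro z hz
      rw [Submonoid.subsemiringClosure_mem] at hz
      induction hz using AddSubmonoid.closure_induction with
      | zero => exact ⟨0, le_rfl, map_zero _⟩
      | mem z hz =>
        obtain ⟨p, hp, y, hy, rfl⟩ := hz
        obtain ⟨y, rfl⟩ := IntermediateField.mem_bot.1 hy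
        exact ⟨p * y ^ 2, mul_nonneg hp (sq_nonneg y), by simp⟩
      | add a b _ _ ha hb =>
        obtain ⟨p, hp, rfl⟩ := ha
        obtain ⟨q, hq, rfl⟩ := hb
        exact ⟨p + q, add_nonneg hp hq, map_add _ _ _⟩
    intro hmem
    obtain ⟨p, hp, h⟩ := key _ hmem
    have : p = -1 := (algebraMap F (AlgebraicClosure F)).injective (by simp [h])
    linarith
  obtain ⟨K, hK⟩ := RealClosure.exists_maximal h0
  have hrc := RealClosure.isRealClosed_of_maximal hK
  refine ⟨K, hrc, fun x hx => ?_⟩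
  rcases hrc.isSquare_or_isSquare_neg (algebraMap F K x) with h | h
  · exact h
  have h1 : algebraMap F K x ∈ RealClosure.preordering K hK.prop :=
    AddSubmonoid.subset_closure ⟨x, hx, 1, one_mem _, by simp⟩
  have h2 : -algebraMap F K x ∈ RealClosure.preordering K hK.prop :=
    RingPreordering.mem_of_isSquare _ h
  rw [RingPreordering.eq_zero_of_mem_of_neg_mem h1 h2]
  exact IsSquare.zero

end

/-! ### Bounded, infinitesimal and infinite elements over an ordered subfield. -/

section

open Polynomial

set_option linter.unusedSectionVars false

/-- A ring homomorphism from a real closed field to an ordered field is strictly monotone. -/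
theorem IsRealClosed.strictMono {R E : Type*} [Field R] [LinearOrder R] [IsStrictOrderedRing R]
    [IsRealClosed R] [Field E] [LinearOrder E] [IsStrictOrderedRing E] (f : R →+* E) :
    StrictMono f := by
  refine Monotone.strictMono_of_injective (fun a b hab => ?_) f.injective
  obtain ⟨c, hc⟩ := IsSquare.of_nonneg (sub_nonneg.2 hab)
  have := congrArg f hc
  rw [map_sub, map_mul] at this
  nlinarith [mul_self_nonneg (f c)]

section Definitions

variable (R : Type*) {E : Type*} [Field R] [LinearOrder R] [Field E] [LinearOrder E] [Algebra R E]

/-- `x` lies between two elements of `R`. -/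
def IsBoundedOver (x : E) : Prop := ∃ r : R, |x| ≤ algebraMap R E r

/-- `x` is smaller in absolute value than every positive element of `R`. -/
def IsInfinitesimalOver (x : E) : Prop := ∀ r : R, 0 < r → |x| < algebraMap R E r

/-- `x` is larger than every element of `R`. -/
def IsInfiniteOver (x : E) : Prop := ∀ r : R, algebraMap R E r < x

variable (E)

/-- Every bounded element of `E` is infinitely close to an element of `R`. -/
def HasStandardParts : Prop :=
  ∀ x : E, IsBoundedOver R x → ∃ r : R, IsInfinitesimalOver R (x - algebraMap R E r)

/-- The powers of every infinite element are cofinal in `E`. -/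
def IsRankLEOneOver : Prop := ∀ f g : E, IsInfiniteOver R f → ∃ n : ℕ, g < f ^ n

end Definitions

section Basic

variable {R E : Type*} [Field R] [LinearOrder R] [IsStrictOrderedRing R]
  [Field E] [LinearOrder E] [IsStrictOrderedRing E] [Algebra R E]

theorem IsInfinitesimalOver.zero (hRE : StrictMono (algebraMap R E)) :
    IsInfinitesimalOver R (0 : E) := fun r hr => by
  simpa using hRE hr

theorem IsInfinitesimalOver.neg {x : E} (hx : IsInfinitesimalOver R x) :
    IsInfinitesimalOver R (-x) := fun r hr => by rw [abs_neg]; exact hx r hr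

theorem IsInfinitesimalOver.add {x y : E} (hx : IsInfinitesimalOver R x)
    (hy : IsInfinitesimalOver R y) : IsInfinitesimalOver R (x + y) := fun r hr => by
  have h1 := hx (r / 2) (half_pos hr)
  have h2 := hy (r / 2) (half_pos hr)
  calc |x + y| ≤ |x| + |y| := abs_add_le _ _
    _ < algebraMap R E (r / 2) + algebraMap R E (r / 2) := add_lt_add h1 h2
    _ = algebraMap R E r := by rw [← map_add, add_halves]

theorem IsInfinitesimalOver.mul_isBoundedOver (hRE : StrictMono (algebraMap R E)) {x y : E}
    (hx : IsInfinitesimalOver R x) (hy : IsBoundedOver R y) : IsInfinitesimalOver R (x * y) := by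
  intro r hr
  obtain ⟨c, hc⟩ := hy
  have hc1 : 0 < |c| + 1 := by positivity
  have h1 := hx (r / (|c| + 1)) (div_pos hr hc1)
  have h2 : |y| < algebraMap R E (|c| + 1) :=
    hc.trans_lt (hRE ((le_abs_self c).trans_lt (lt_add_one _)))
  calc |x * y| = |x| * |y| := abs_mul _ _
    _ < algebraMap R E (r / (|c| + 1)) * algebraMap R E (|c| + 1) :=
      mul_lt_mul'' h1 h2 (abs_nonneg _) (abs_nonneg _)
    _ = algebraMap R E r := by rw [← map_mul, div_mul_cancel₀ _ hc1.ne']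

theorem IsInfinitesimalOver.sum (hRE : StrictMono (algebraMap R E)) {ι : Type*} {s : Finset ι}
    {f : ι → E} (h : ∀ i ∈ s, IsInfinitesimalOver R (f i)) :
    IsInfinitesimalOver R (∑ i ∈ s, f i) := by
  classical
  induction s using Finset.induction_on with
  | empty => simpa using IsInfinitesimalOver.zero hRE
  | insert i s hi ih =>
    rw [Finset.sum_insert hi]
    exact (h i (Finset.mem_insert_self _ _)).add (ih fun j hj => h j (Finset.mem_insert_of_mem hj))

theorem IsInfinitesimalOver.of_mul {x y : E} (h : IsInfinitesimalOver R (x * y)) :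
    IsInfinitesimalOver R x ∨ IsInfinitesimalOver R y := by
  by_contra! hxy
  obtain ⟨hx, hy⟩ := hxy
  simp only [IsInfinitesimalOver, not_forall, not_lt] at hx hy
  obtain ⟨r, hr, hx⟩ := hx
  obtain ⟨s, hs, hy⟩ := hy
  have := h (r * s) (mul_pos hr hs)
  rw [abs_mul, map_mul] at this
  -- Monotonicity of the embedding is not assumed; a negative image of `s` would contradict `h` at
  -- `s`.
  by_cases h0 : 0 ≤ algebraMap R E s
  · exact absurd this (mul_le_mul hx hy h0 (abs_nonneg _)).not_gt
  · have := h s hs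
    linarith [abs_nonneg (x * y)]

theorem IsInfinitesimalOver.eq_zero {r : R}
    (h : IsInfinitesimalOver R (algebraMap R E r)) : r = 0 := by
  by_contra hr
  have h1 := h |r| (abs_pos.2 hr)
  rcases abs_choice r with h2 | h2 <;> rw [h2] at h1
  · exact absurd h1 (le_abs_self _).not_gt
  · rw [map_neg] at h1
    exact absurd h1 (neg_le_abs _).not_gt

theorem IsBoundedOver.pow {x : E} (hx : IsBoundedOver R x) (n : ℕ) : IsBoundedOver R (x ^ n) := by
  obtain ⟨r, hr⟩ := hx
  exact ⟨r ^ n, by rw [abs_pow, map_pow]; exact pow_le_pow_left₀ (abs_nonneg _) hr n⟩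

theorem IsInfiniteOver.pos {x : E} (hx : IsInfiniteOver R x) : 0 < x := by simpa using hx 0

/-- A bounded element of a field with standard parts cuts the base field at a point. -/
theorem HasStandardParts.isDedekindCompleteIn (hRE : StrictMono (algebraMap R E))
    (h : HasStandardParts R E) : IsDedekindCompleteIn R E := by
  rintro s ⟨a, b, ha, hb⟩
  obtain ⟨r, hr⟩ := h s ⟨max |a| |b|, by
    rw [abs_le']
    constructor
    · exact hb.trans (hRE.monotone ((le_abs_self b).trans (le_max_right _ _)))
    · rw [neg_le, ← map_neg]
      exact (hRE.monotone (neg_le.1 ((neg_le_abs a).trans (le_max_left _ _)))).trans ha⟩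
  refine ⟨r, fun x hx => ?_, fun u hu => ?_⟩
  · by_contra! hlt
    have h1 := (abs_lt.1 (hr (x - r) (sub_pos.2 hlt))).2
    rw [map_sub] at h1
    have hx : algebraMap R E x ≤ s := hx
    linarith
  · by_contra! hlt
    have h1 := (abs_lt.1 (hr ((r - u) / 2) (by linarith))).1
    have h2 : algebraMap R E (r - (r - u) / 2) ≤ s := by rw [map_sub]; linarith
    have h3 : r - (r - u) / 2 ≤ u := hu h2
    linarith

theorem IsDedekindCompleteIn.hasStandardParts (hRE : StrictMono (algebraMap R E))
    (h : IsDedekindCompleteIn R E) : HasStandardParts R E := by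
  rintro s ⟨c, hc⟩
  obtain ⟨r, hr⟩ := h s ⟨-c, c, by rw [map_neg]; exact (abs_le.1 hc).1, (abs_le.1 hc).2⟩
  refine ⟨r, fun d hd => abs_lt.2 ⟨?_, ?_⟩⟩
  · by_contra! hle
    have : r ≤ r - d := hr.2 fun x hx => by
      have hx : algebraMap R E x ≤ s := hx
      refine hRE.le_iff_le.1 ?_
      rw [map_sub]; linarith
    linarith
  · by_contra! hle
    have : r + d ≤ r := hr.1 (by
      change algebraMap R E (r + d) ≤ s
      rw [map_add]; linarith)
    linarith

/-- Standard parts descend to subextensions. -/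
theorem HasStandardParts.of_algHom {S : Type*} [Field S] [LinearOrder S] [IsStrictOrderedRing S]
    [Algebra R S] (h : HasStandardParts R E) (f : S →ₐ[R] E) (hf : StrictMono f) :
    HasStandardParts R S := by
  have habs (x : S) : f |x| = |f x| := hf.monotone.map_max.trans (by rw [map_neg]; rfl)
  rintro x ⟨c, hc⟩
  obtain ⟨r, hr⟩ := h (f x) ⟨c, by
    rw [← habs, ← f.commutes]; exact hf.monotone hc⟩
  refine ⟨r, fun d hd => hf.lt_iff_lt.1 ?_⟩
  rw [habs, map_sub, f.commutes, f.commutes]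
  exact hr d hd

theorem IsInfiniteOver.map {S : Type*} [Field S] [LinearOrder S] [Algebra R S]
    {x : S} (hx : IsInfiniteOver R x) (f : S →ₐ[R] E) (hf : StrictMono f) :
    IsInfiniteOver R (f x) := fun r => by
  rw [← f.commutes]; exact hf (hx r)

theorem IsRankLEOneOver.of_algHom {S : Type*} [Field S] [LinearOrder S] [Algebra R S]
    (h : IsRankLEOneOver R E) (f : S →ₐ[R] E) (hf : StrictMono f) :
    IsRankLEOneOver R S := by
  intro x y hx
  obtain ⟨n, hn⟩ := h (f x) (f y) (hx.map f hf)
  exact ⟨n, hf.lt_iff_lt.1 (by rwa [map_pow])⟩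

end Basic

/-! ### Standard parts and rank one persist in algebraic extensions. -/

section Algebraic

variable {R F E : Type*} [Field R] [LinearOrder R] [IsStrictOrderedRing R]
  [Field F] [LinearOrder F] [IsStrictOrderedRing F]
  [Field E] [LinearOrder E] [IsStrictOrderedRing E]
  [Algebra R F] [Algebra R E] [Algebra F E] [IsScalarTower R F E]

/-- A near root of a nonzero polynomial over a real closed field `R` is infinitely close to an
element of `R`. -/
theorem exists_isInfinitesimalOver_sub [IsRealClosed R] {p : R[X]} (hp : p ≠ 0) {x : E}
    (h : IsInfinitesimalOver R (aeval x p)) :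
    ∃ r : R, IsInfinitesimalOver R (x - algebraMap R E r) := by
  have hRE := IsRealClosed.strictMono (algebraMap R E)
  induction hn : p.natDegree using Nat.strong_induction_on generalizing p with
  | h n ih =>
    by_cases hd : p.degree = 0
    · rw [eq_C_of_degree_eq_zero hd, aeval_C] at h
      have h0 := h.eq_zero
      rw [eq_C_of_degree_eq_zero hd, h0, map_zero] at hp
      exact absurd rfl hp
    rcases IsRealClosed.exists_dvd p hd with ⟨a, q, hq⟩ | ⟨a, b, hb, q, hq⟩
    · have hq0 : q ≠ 0 := by rintro rfl; simp [hq] at hp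
      rw [hq, map_mul] at h
      rcases h.of_mul with h | h
      · exact ⟨a, by simpa using h⟩
      · refine ih q.natDegree ?_ hq0 h rfl
        rw [← hn, hq, natDegree_mul (X_sub_C_ne_zero a) hq0, natDegree_X_sub_C]
        omega
    · have hq0 : q ≠ 0 := by rintro rfl; simp [hq] at hp
      rw [hq, map_mul] at h
      rcases h.of_mul with h | h
      -- The quadratic factor is at least `b ^ 2` everywhere, so it is not infinitesimal.
      · exfalso
        have h1 := (abs_lt.1 (h (b ^ 2) (by positivity))).2
        simp only [map_add, map_pow, map_sub, aeval_X, aeval_C] at h1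
        nlinarith [sq_nonneg (x - algebraMap R E a)]
      · have h2 : ((X - C a) ^ 2 + C (b ^ 2)).natDegree = 2 := by compute_degree!
        refine ih q.natDegree ?_ hq0 h rfl
        rw [← hn, hq, natDegree_mul (by intro h; rw [h] at h2; simp at h2) hq0, h2]
        omega

/-- An element algebraic over `F` is a root of an infinitesimal perturbation of a nonzero
polynomial over `R`. -/
theorem HasStandardParts.exists_aeval_add_sum_eq_zero (hF : HasStandardParts R F)
    {x : E} (hx : IsAlgebraic F x) :
    ∃ p : R[X], p ≠ 0 ∧ ∃ (n : ℕ) (ε : ℕ → F), (∀ i, IsInfinitesimalOver R (ε i)) ∧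
      aeval x p + ∑ i ∈ Finset.range (n + 1), algebraMap F E (ε i) * x ^ i = 0 := by
  obtain ⟨P, hP0, hP⟩ := hx
  -- Dividing by the coefficient of largest absolute value makes all coefficients bounded and one of
  -- them `1`, so their standard parts form a nonzero polynomial.
  obtain ⟨m, hm, hmax⟩ := Finset.exists_max_image P.support (fun i => |P.coeff i|)
    (nonempty_support_iff.2 hP0)
  have hm0 : P.coeff m ≠ 0 := mem_support_iff.1 hm
  have hle (i : ℕ) : |P.coeff i| ≤ |P.coeff m| := by
    by_cases hi : i ∈ P.support
    · exact hmax i hi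
    · rw [notMem_support_iff.1 hi, abs_zero]; exact abs_nonneg _
  have hb (i : ℕ) : IsBoundedOver R (P.coeff i / P.coeff m) :=
    ⟨1, by rw [map_one, abs_div]; exact div_le_one_of_le₀ (hle i) (abs_nonneg _)⟩
  choose r hr using fun i => hF _ (hb i)
  have hrm : r m ≠ 0 := by
    intro h0
    have h1 := hr m 1 one_pos
    rw [h0, map_zero, sub_zero, div_self hm0, map_one, abs_one] at h1
    exact lt_irrefl _ h1
  set n := P.natDegree
  let p : R[X] := ∑ i ∈ Finset.range (n + 1), C (r i) * X ^ i
  refine ⟨p, ?_, n, fun i => P.coeff i / P.coeff m - algebraMap R F (r i), hr, ?_⟩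
  · intro h0
    have h1 : p.coeff m = r m := by
      simp only [p, finsetSum_coeff, coeff_C_mul, coeff_X_pow]
      rw [Finset.sum_eq_single m]
      · simp
      · intro i _ hi
        simp [hi.symm]
      · intro h
        exact absurd (Finset.mem_range.2 (Nat.lt_succ_of_le (le_natDegree_of_mem_supp m hm))) h
    rw [h0, coeff_zero] at h1
    exact hrm h1.symm
  · rw [aeval_eq_sum_range] at hP
    simp only [p, map_sum, map_mul, aeval_C, map_pow, aeval_X]
    rw [← Finset.sum_add_distrib]
    have h2 : ∀ i ∈ Finset.range (n + 1), algebraMap R E (r i) * x ^ i +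
        algebraMap F E (P.coeff i / P.coeff m - algebraMap R F (r i)) * x ^ i =
        algebraMap F E (P.coeff m)⁻¹ * (P.coeff i • x ^ i) := by
      intro i _
      rw [Algebra.smul_def, map_sub, ← IsScalarTower.algebraMap_apply, div_eq_inv_mul, map_mul]
      ring
    rw [Finset.sum_congr rfl h2, ← Finset.mul_sum, hP, mul_zero]

theorem IsInfinitesimalOver.map_algebraMap {x : F} (hx : IsInfinitesimalOver R x)
    (hFE : StrictMono (algebraMap F E)) : IsInfinitesimalOver R (algebraMap F E x) := by
  intro r hr
  have habs : algebraMap F E |x| = |algebraMap F E x| :=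
    hFE.monotone.map_max.trans (by rw [map_neg]; rfl)
  rw [← habs, IsScalarTower.algebraMap_apply R F E]
  exact hFE (hx r hr)

/-- Standard parts over a real closed field persist in algebraic extensions. -/
theorem HasStandardParts.of_isAlgebraic [IsRealClosed R] [Algebra.IsAlgebraic F E]
    (hF : HasStandardParts R F) (hFE : StrictMono (algebraMap F E)) : HasStandardParts R E := by
  have hRE := IsRealClosed.strictMono (algebraMap R E)
  intro x hx
  obtain ⟨p, hp, n, ε, hε, h⟩ := hF.exists_aeval_add_sum_eq_zero
    (Algebra.IsAlgebraic.isAlgebraic (R := F) x)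
  refine exists_isInfinitesimalOver_sub hp ?_
  rw [eq_neg_of_add_eq_zero_left h]
  exact (IsInfinitesimalOver.sum hRE fun i _ =>
    ((hε i).map_algebraMap hFE).mul_isBoundedOver hRE (hx.pow i)).neg

/-- An ordered field is cofinal in its ordered algebraic extensions. -/
theorem exists_lt_algebraMap [Algebra.IsAlgebraic F E] (hFE : StrictMono (algebraMap F E))
    (x : E) : ∃ y : F, x < algebraMap F E y := by
  have hx : IsIntegral F x := Algebra.IsIntegral.isIntegral x
  set P := minpoly F x
  have habs (x : F) : algebraMap F E |x| = |algebraMap F E x| :=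
    hFE.monotone.map_max.trans (by rw [map_neg]; rfl)
  -- Cauchy's bound for the roots of a monic polynomial.
  refine ⟨∑ i ∈ Finset.range P.natDegree, |P.coeff i| + 1, ?_⟩
  rw [map_add, map_one, map_sum]
  have hsum : 0 ≤ ∑ i ∈ Finset.range P.natDegree, algebraMap F E |P.coeff i| :=
    Finset.sum_nonneg fun i _ => by rw [habs]; exact abs_nonneg _
  by_contra! hle
  have hx1 : 1 ≤ x := by linarith
  have hx0 : 0 < x := by linarith
  have h0 : aeval x P = 0 := minpoly.aeval F x
  rw [aeval_eq_sum_range, Finset.sum_range_succ, (minpoly.monic hx).coeff_natDegree, one_smul] at h0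
  obtain ⟨k, hk⟩ : ∃ k, P.natDegree = k + 1 :=
    Nat.exists_eq_succ_of_ne_zero (minpoly.natDegree_pos hx).ne'
  have h1 : x ^ P.natDegree ≤ (∑ i ∈ Finset.range P.natDegree, algebraMap F E |P.coeff i|) *
      x ^ k := by
    rw [eq_neg_of_add_eq_zero_right h0, ← Finset.sum_neg_distrib, Finset.sum_mul]
    refine Finset.sum_le_sum fun i hi => ?_
    have hik : i ≤ k := by have := Finset.mem_range.1 hi; omega
    rw [Algebra.smul_def, ← neg_mul, habs]
    exact (mul_le_mul_of_nonneg_right (neg_le_abs _) (by positivity)).trans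
      (mul_le_mul_of_nonneg_left (pow_le_pow_right₀ hx1 hik) (abs_nonneg _))
  rw [hk, pow_succ'] at h1
  rw [← hk] at h1
  have := le_of_mul_le_mul_right h1 (by positivity)
  linarith

/-- Rank one over a real closed field persists in algebraic extensions. -/
theorem IsRankLEOneOver.of_isAlgebraic [IsRealClosed R] [Algebra.IsAlgebraic F E]
    (hF : HasStandardParts R F) (hF' : IsRankLEOneOver R F)
    (hFE : StrictMono (algebraMap F E)) : IsRankLEOneOver R E := by
  have hRE := IsRealClosed.strictMono (algebraMap R E)
  have hRF := IsRealClosed.strictMono (algebraMap R F)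
  have habs (x : F) : algebraMap F E |x| = |algebraMap F E x| :=
    hFE.monotone.map_max.trans (by rw [map_neg]; rfl)
  intro f g hf
  have hf0 := hf.pos
  have hf1 : 1 ≤ f := by simpa using (hf 1).le
  obtain ⟨p, hp, n, ε, hε, h⟩ := hF.exists_aeval_add_sum_eq_zero
    (Algebra.IsAlgebraic.isAlgebraic (R := F) f)
  -- Otherwise `f` would be infinitely close to an element of `R`.
  have hnot : ¬ IsInfinitesimalOver R (aeval f p) := by
    intro hinf
    obtain ⟨r, hr⟩ := exists_isInfinitesimalOver_sub hp hinf
    have h1 := (abs_lt.1 (hr 1 one_pos)).2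
    have h2 := hf (r + 1)
    rw [map_add] at h2
    linarith
  simp only [IsInfinitesimalOver, not_forall, not_lt] at hnot
  obtain ⟨r, hr, hle⟩ := hnot
  rw [eq_neg_of_add_eq_zero_left h, abs_neg] at hle
  obtain ⟨i, -, hi⟩ : ∃ i ∈ Finset.range (n + 1),
      algebraMap R E (r / (n + 1)) ≤ algebraMap F E |ε i| * f ^ n := by
    by_contra! hlt
    have h1 : |∑ i ∈ Finset.range (n + 1), algebraMap F E (ε i) * f ^ i| <
        ∑ i ∈ Finset.range (n + 1), algebraMap R E (r / (n + 1)) := by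
      refine (Finset.abs_sum_le_sum_abs _ _).trans_lt
        (Finset.sum_lt_sum_of_nonempty ⟨0, by simp⟩ fun i hi => ?_)
      refine lt_of_le_of_lt ?_ (hlt i hi)
      rw [abs_mul, habs, abs_of_pos (pow_pos hf0 i)]
      exact mul_le_mul_of_nonneg_left
        (pow_le_pow_right₀ hf1 (Nat.lt_succ_iff.1 (Finset.mem_range.1 hi))) (abs_nonneg _)
    have h2 : ∑ i ∈ Finset.range (n + 1), algebraMap R E (r / (n + 1)) = algebraMap R E r := by
      rw [Finset.sum_const, Finset.card_range, ← map_nsmul, nsmul_eq_mul]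
      congr 1
      push_cast
      field_simp
    rw [h2] at h1
    exact absurd hle h1.not_ge
  set s := r / (n + 1) with hs
  have hs0 : 0 < s := by positivity
  have hε0 : 0 < |ε i| := by
    rw [abs_pos]
    intro h0
    rw [h0, abs_zero, map_zero, zero_mul] at hi
    have := hRE hs0
    rw [map_zero] at this
    linarith
  -- This infinite element of `F` is at most `f ^ n`. Its powers are cofinal in `F`, which is itself
  -- cofinal in `E`.
  have hinf : IsInfiniteOver R (algebraMap R F s / |ε i|) := by
    intro t
    rw [lt_div_iff₀ hε0]
    have h1 : |t| + 1 > 0 := by positivity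
    have h2 := hε i (s / (|t| + 1)) (div_pos hs0 h1)
    calc algebraMap R F t * |ε i| ≤ algebraMap R F (|t| + 1) * |ε i| :=
          mul_le_mul_of_nonneg_right (hRF.monotone (by linarith [le_abs_self t])) hε0.le
      _ < algebraMap R F (|t| + 1) * algebraMap R F (s / (|t| + 1)) :=
          mul_lt_mul_of_pos_left h2 (by simpa using hRF h1)
      _ = algebraMap R F s := by rw [← map_mul, mul_div_cancel₀ _ h1.ne']
  obtain ⟨y, hy⟩ := exists_lt_algebraMap hFE g
  obtain ⟨k, hk⟩ := hF' _ y hinf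
  refine ⟨n * k, ?_⟩
  rw [pow_mul]
  refine hy.trans ((hFE hk).trans_le ?_)
  rw [map_pow]
  refine pow_le_pow_left₀ ?_ ?_ k
  · have := hFE hinf.pos
    rw [map_zero] at this
    exact this.le
  · rw [map_div₀, ← IsScalarTower.algebraMap_apply, div_le_iff₀ (by simpa using hFE hε0), mul_comm]
    exact hi

end Algebraic

end

/-! ### Algebraic independence from multiplicative archimedean classes. -/

section

open MvPolynomial

/-- A nonempty sum of elements in distinct archimedean classes is in the class of a summand. -/
theorem ArchimedeanClass.exists_mk_sum_eq {ι G : Type*} [AddCommGroup G] [LinearOrder G]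
    [IsOrderedAddMonoid G] {s : Finset ι} (hs : s.Nonempty) {a : ι → G}
    (h : Set.InjOn (fun i => mk (a i)) s) : ∃ i ∈ s, mk (∑ j ∈ s, a j) = mk (a i) := by
  classical
  induction hs using Finset.Nonempty.cons_induction with
  | singleton i => exact ⟨i, by simp⟩
  | cons i s hi hs ih =>
    obtain ⟨j, hj, hmk⟩ := ih (h.mono (by simp))
    rw [Finset.sum_cons]
    have hij : i ≠ j := by rintro rfl; exact hi hj
    have hne : mk (a i) ≠ mk (a j) := fun heq =>
      hij (h (Finset.mem_cons_self i s) (Finset.mem_cons_of_mem hj) heq)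
    rcases lt_or_gt_of_ne hne with hlt | hlt
    · exact ⟨i, Finset.mem_cons_self i s, mk_add_eq_mk_left (by rwa [hmk])⟩
    · exact ⟨j, Finset.mem_cons_of_mem hj, by rw [← hmk]; exact mk_add_eq_mk_right (by rwa [hmk])⟩

theorem MulArchimedeanClass.mk_zpow_eq {G : Type*} [CommGroup G] [LinearOrder G]
    [IsOrderedMonoid G] (a : G) {z : ℤ} (hz : z ≠ 0) : mk (a ^ z) = mk a := by
  have h : |a ^ z|ₘ = |a|ₘ ^ z.natAbs := by
    rw [mabs_zpow, Int.abs_eq_natAbs, zpow_natCast]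
  refine mk_eq_mk.2 ⟨⟨1, ?_⟩, ⟨z.natAbs, h.le⟩⟩
  rw [pow_one, h]
  exact le_self_pow (one_le_mabs a) (Int.natAbs_ne_zero.2 hz)

section

variable {S N : Type*} [Field S] [Field N] [LinearOrder N] [IsStrictOrderedRing N] [Algebra S N]

/-- The absolute value of a nonzero element, as a positive element. -/
def posAbs (x : N) (hx : x ≠ 0) : {x : N // 0 < x} := ⟨|x|, abs_pos.2 hx⟩

theorem posAbs_div {x y z : N} (h : z = x / y) (hx : x ≠ 0) (hy : y ≠ 0) (hz : z ≠ 0) :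
    posAbs z hz = posAbs x hx / posAbs y hy := by
  subst h
  rw [div_eq_mul_inv (posAbs x hx)]
  refine Subtype.ext ?_
  change |x / y| = |x| * |y|⁻¹
  rw [abs_div, div_eq_mul_inv]

/-- Positive infinite elements whose multiplicative archimedean classes are pairwise distinct, and
distinct from those of the elements of a subfield, are algebraically independent over it. -/
theorem algebraicIndependent_of_mulArchimedeanClass {ι : Type*} [LinearOrder ι]
    (X : ι → {x : N // 0 < x})
    (hX : StrictMono fun i => MulArchimedeanClass.mk (X i))
    (hXn : ∀ i, ∀ n : ℕ, (n : N) < X i)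
    (h : ∀ i, ∀ s : S, ∀ hs : algebraMap S N s ≠ 0,
      MulArchimedeanClass.mk (posAbs (algebraMap S N s) hs) ≠ MulArchimedeanClass.mk (X i)) :
    AlgebraicIndependent S (fun i => (X i : N)) := by
  rw [algebraicIndependent_iff]
  intro p hp
  by_contra hp0
  let mon : (ι →₀ ℕ) → {x : N // 0 < x} := fun d => d.prod fun i n => X i ^ n
  let a : (ι →₀ ℕ) → N := fun d => algebraMap S N (p.coeff d) * mon d
  have hmon (d : ι →₀ ℕ) : (mon d : N) = d.prod fun i n => (X i : N) ^ n := by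
    simp only [mon, Finsupp.prod]
    induction d.support using Finset.cons_induction with
    | empty => simp
    | cons i s hi ih => rw [Finset.prod_cons, Finset.prod_cons, Positive.val_mul, ih]; rfl
  have hsum : ∑ d ∈ p.support, a d = 0 := by
    rw [← hp, aeval_def, eval₂_eq]
    refine Finset.sum_congr rfl fun d _ => ?_
    simp only [a, hmon, Finsupp.prod]
  -- The terms of a relation lie in distinct additive classes. If two were comparable, the quotient
  -- of their monomials would equal a quotient of coefficients up to a factor bounded, with its
  -- inverse, by a natural number.
  have hinj : Set.InjOn (fun d => ArchimedeanClass.mk (a d)) p.support := by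
    intro d hd d' hd' heq
    by_contra hne
    have hc : algebraMap S N (p.coeff d) ≠ 0 := by
      simpa using MvPolynomial.mem_support_iff.1 hd
    have hc' : algebraMap S N (p.coeff d') ≠ 0 := by
      simpa using MvPolynomial.mem_support_iff.1 hd'
    have hq : algebraMap S N (p.coeff d' / p.coeff d) ≠ 0 := by
      rw [map_div₀]; exact div_ne_zero hc' hc
    obtain ⟨⟨m, hm⟩, ⟨n, hn⟩⟩ := ArchimedeanClass.mk_eq_mk.1 heq
    let A : {x : N // 0 < x} := posAbs _ hc * mon d
    let A' : {x : N // 0 < x} := posAbs _ hc' * mon d'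
    have hA : (A : N) = |a d| := by
      simp only [A, a, Positive.val_mul, abs_mul, posAbs]
      rw [abs_of_pos (mon d).2]
    have hA' : (A' : N) = |a d'| := by
      simp only [A', a, Positive.val_mul, abs_mul, posAbs]
      rw [abs_of_pos (mon d').2]
    let z : ι → ℤ := fun i => (d i : ℤ) - d' i
    let J : Finset ι := {i ∈ d.support ∪ d'.support | d i ≠ d' i}
    have hJ : J.Nonempty := by
      obtain ⟨i, hi⟩ := DFunLike.ne_iff.1 hne
      refine ⟨i, Finset.mem_filter.2 ⟨?_, hi⟩⟩
      rw [Finset.mem_union, Finsupp.mem_support_iff, Finsupp.mem_support_iff]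
      omega
    have hu : mon d / mon d' = ∏ i ∈ J, X i ^ z i := by
      have h1 : mon d = ∏ i ∈ d.support ∪ d'.support, X i ^ d i :=
        Finsupp.prod_of_support_subset _ Finset.subset_union_left _ (by simp)
      have h2 : mon d' = ∏ i ∈ d.support ∪ d'.support, X i ^ d' i :=
        Finsupp.prod_of_support_subset _ Finset.subset_union_right _ (by simp)
      rw [h1, h2, ← Finset.prod_div_distrib, Finset.prod_filter]
      refine Finset.prod_congr rfl fun i _ => ?_
      split_ifs with hi
      · rw [zpow_sub, zpow_natCast, zpow_natCast, div_eq_mul_inv]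
      · rw [not_not] at hi
        rw [hi, div_self']
    -- Smaller classes contain larger elements, so the least index at which the exponents differ
    -- dominates.
    have hmku : MulArchimedeanClass.mk (mon d / mon d') =
        MulArchimedeanClass.mk (X (J.min' hJ)) := by
      have hz (i) (hi : i ∈ J) : z i ≠ 0 := by
        have := (Finset.mem_filter.1 hi).2
        simp only [z]; omega
      have hcl (i) (hi : i ∈ J) : MulArchimedeanClass.mk (X i ^ z i) =
          MulArchimedeanClass.mk (X i) := MulArchimedeanClass.mk_zpow_eq _ (hz i hi)
      rw [hu, MulArchimedeanClass.mk_prod hJ, hcl _ (Finset.min'_mem _ _)]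
      intro i hi j hj hij
      simp only [Function.comp_apply]
      rw [hcl i hi, hcl j hj]
      exact hX hij
    have hw : MulArchimedeanClass.mk (mon d / mon d') < MulArchimedeanClass.mk (A / A') := by
      rw [hmku, MulArchimedeanClass.mk_lt_mk]
      intro k
      have hB (B B' : {x : N // 0 < x}) (n : ℕ) (hB : (B : N) ≤ n * B') :
          ((B / B' : {x : N // 0 < x}) : N) ≤ n := by
        rw [div_eq_mul_inv, Positive.val_mul, Positive.coe_inv, ← div_eq_mul_inv]
        exact (div_le_iff₀ B'.2).2 hB
      have h1 : ((A / A' : {x : N // 0 < x}) : N) ≤ max (m : N) n :=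
        (hB A A' n (by rw [hA, hA', ← nsmul_eq_mul]; exact hn)).trans
          (le_max_right _ _)
      have h2 : (((A / A')⁻¹ : {x : N // 0 < x}) : N) ≤ max (m : N) n := by
        rw [inv_div]
        exact (hB A' A m (by rw [hA, hA', ← nsmul_eq_mul]; exact hm)).trans
          (le_max_left _ _)
      have h3 : ((|A / A'|ₘ : {x : N // 0 < x}) : N) ≤ ((max m n : ℕ) : N) := by
        rw [Nat.cast_max]
        rcases le_total (A / A') (A / A')⁻¹ with h | h
        · rw [mabs, sup_eq_right.2 h]; exact h2
        · rw [mabs, sup_eq_left.2 h]; exact h1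
      refine lt_of_lt_of_le ?_ (le_mabs_self _)
      rw [← Subtype.coe_lt_coe, Positive.val_pow]
      refine (pow_le_pow_left₀ |A / A'|ₘ.2.le h3 k).trans_lt ?_
      exact_mod_cast hXn _ (max m n ^ k)
    have hqe : posAbs _ hq = (mon d / mon d') / (A / A') := by
      rw [posAbs_div (map_div₀ _ _ _) hc' hc hq]
      simp only [A, A', div_eq_mul_inv, mul_inv, inv_inv]
      rw [show mon d * (mon d')⁻¹ * ((posAbs _ hc)⁻¹ * (mon d)⁻¹ * (posAbs _ hc' * mon d')) =
        posAbs _ hc' * (posAbs _ hc)⁻¹ * (mon d * (mon d)⁻¹) * (mon d' * (mon d')⁻¹) by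
          ac_rfl]
      simp
    refine h (J.min' hJ) _ hq ?_
    rw [hqe, MulArchimedeanClass.mk_div_eq_mk_left hw, hmku]
  -- A sum of terms in distinct classes has the class of one of them, so it cannot vanish.
  obtain ⟨d, hd, hmk⟩ := ArchimedeanClass.exists_mk_sum_eq
    (MvPolynomial.support_nonempty.2 hp0) hinj
  rw [hsum, ArchimedeanClass.mk_zero, eq_comm, ArchimedeanClass.mk_eq_top_iff] at hmk
  refine mul_ne_zero ?_ (mon d).2.ne' hmk
  simpa using MvPolynomial.mem_support_iff.1 hd

end

end

section

/-! ### Relatively algebraically closed subfields -/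

open Polynomial in
/-- A relatively algebraically closed subfield of a real closed field is real closed. -/
theorem IsRealClosed.of_forall_isAlgebraic {A K : Type*} [Field A] [Field K] [Algebra A K]
    [IsRealClosed K] (h : ∀ y : K, IsAlgebraic A y → y ∈ Set.range (algebraMap A K)) :
    IsRealClosed A where
  one_add_ne_zero {s} hs h0 := by
    have h1 : IsSumSq (algebraMap A K s) := by
      clear h0
      induction hs with
      | zero => rw [map_zero]; exact IsSumSq.zero
      | sq_add a hs ih =>
        rw [map_add, map_mul]
        exact (IsSumSq.mul_self _).add ih
    refine IsSemireal.one_add_ne_zero h1 ?_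
    rw [← map_one (algebraMap A K), ← map_add, h0, map_zero]
  isSquare_or_isSquare_neg x := by
    have key (z : A) (hz : IsSquare (algebraMap A K z)) : IsSquare z := by
      obtain ⟨y, hy⟩ := hz
      obtain ⟨w, rfl⟩ := h y (IsAlgebraic.of_pow two_pos (by
        rw [sq, ← hy]; exact isAlgebraic_algebraMap z))
      exact ⟨w, (algebraMap A K).injective (by rw [hy, map_mul])⟩
    rcases isSquare_or_isSquare_neg (algebraMap A K x) with hx | hx
    · exact .inl (key x hx)
    · exact .inr (key (-x) (by rwa [map_neg]))
  exists_isRoot_of_odd_natDegree {f} hf := by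
    obtain ⟨y, hy⟩ := exists_isRoot_of_odd_natDegree (f := f.map (algebraMap A K))
      (by rwa [natDegree_map])
    have hf0 : f ≠ 0 := by rintro rfl; simp at hf
    rw [IsRoot, eval_map_algebraMap] at hy
    obtain ⟨w, rfl⟩ := h y ⟨f, hf0, hy⟩
    refine ⟨w, (algebraMap A K).injective ?_⟩
    rw [map_zero, ← hy, aeval_algebraMap_apply]
    rfl

/-- An algebraically independent family of an ordered extension `F` of `R` is a transcendence basis
of a real closed extension of `R` that is algebraic over `F`. -/
theorem exists_isRealClosed_isTranscendenceBasis {R F : Type u} [Field R] [LinearOrder R]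
    [Field F] [LinearOrder F] [IsStrictOrderedRing F]
    [Algebra R F] {ι : Type*} {x : ι → F} (hx : AlgebraicIndependent R x) :
    ∃ (K M : Type u) (_ : Field K) (_ : LinearOrder K) (_ : IsStrictOrderedRing K)
      (_ : Field M) (_ : LinearOrder M) (_ : IsStrictOrderedRing M)
      (_ : Algebra R K) (_ : Algebra R M) (_ : Algebra F K) (_ : IsScalarTower R F K)
      (f : M →ₐ[R] K) (y : ι → M),
      IsRealClosed M ∧ Algebra.IsAlgebraic F K ∧ StrictMono (algebraMap F K) ∧ StrictMono f ∧
      IsTranscendenceBasis R y ∧ ∀ i, f (y i) = algebraMap F K (x i) := by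
  obtain ⟨K, hK, hKF⟩ := exists_realClosure F
  let _ := IsRealClosed.linearOrder K
  have := IsRealClosed.isStrictOrderedRing_linearOrder K
  have hFK : StrictMono (algebraMap F K) :=
    Monotone.strictMono_of_injective (fun a b hab => by
      have := (hKF _ (sub_nonneg.2 hab)).nonneg
      rwa [map_sub, sub_nonneg] at this) (algebraMap F K).injective
  let xK : ι → K := fun i => algebraMap F K (x i)
  -- `M` is the relative algebraic closure of `R(x)` in `K`: real closed, with no transcendental
  -- elements beyond those `x` accounts for.
  let A := IntermediateField.adjoin R (Set.range xK)
  let M := (algebraicClosure A K)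
  have hM : IsRealClosed M := IsRealClosed.of_forall_isAlgebraic (K := K) fun y hy => by
    refine ⟨⟨y, mem_algebraicClosure_iff.2 ?_⟩, rfl⟩
    exact IsAlgebraic.restrictScalars A hy
  let _ := IsRealClosed.linearOrder M
  have := IsRealClosed.isStrictOrderedRing_linearOrder M
  let f : M →ₐ[R] K := M.val.restrictScalars R
  have hxM (i : ι) : xK i ∈ M := by
    have : xK i ∈ A := IntermediateField.subset_adjoin _ _ ⟨i, rfl⟩
    exact M.algebraMap_mem ⟨xK i, this⟩
  let y : ι → M := fun i => ⟨xK i, hxM i⟩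
  have hxK : AlgebraicIndependent R xK :=
    hx.map' (f := IsScalarTower.toAlgHom R F K) (algebraMap F K).injective
  have hy : AlgebraicIndependent R y := AlgebraicIndependent.of_comp f hxK
  refine ⟨K, M, inferInstance, inferInstance, inferInstance, inferInstance, inferInstance,
    inferInstance, inferInstance, inferInstance, inferInstance, inferInstance, f, y, hM,
    inferInstance, hFK, IsRealClosed.strictMono f.toRingHom, ?_, fun i => rfl⟩
  rw [hy.isTranscendenceBasis_iff_isAlgebraic]
  refine ⟨fun m => ?_⟩
  have h1 : IsAlgebraic A (m : K) := mem_algebraicClosure_iff.1 m.2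
  rw [IntermediateField.isAlgebraic_adjoin_iff] at h1
  let g : Algebra.adjoin R (Set.range y) ≃ₐ[R] Algebra.adjoin R (Set.range xK) :=
    ((Algebra.adjoin R (Set.range y)).equivMapOfInjective f f.injective).trans
      (Subalgebra.equivOfEq _ _ (by
        rw [AlgHom.map_adjoin, ← Set.range_comp]; rfl))
  refine (isAlgebraic_ringHom_iff_of_comp_eq g.toRingEquiv f.toRingHom f.injective ?_).1 h1
  ext z
  rfl

end

/-! ### Hahn series as ordered fields, and independent exponentials. -/

section

open HahnSeries

set_option linter.unusedSectionVars false

section LexHahn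

variable {Γ R : Type*} [AddCommGroup Γ] [LinearOrder Γ] [IsOrderedAddMonoid Γ]
  [Field R] [LinearOrder R] [IsStrictOrderedRing R]

/-- The constant series, as a ring homomorphism to the ordered field of Hahn series. -/
noncomputable def HahnSeries.lexC : R →+* Lex R⟦Γ⟧ where
  toFun r := toLex (C r)
  map_one' := by rw [map_one]; rfl
  map_mul' a b := by rw [map_mul]; rfl
  map_zero' := by rw [map_zero]; rfl
  map_add' a b := by rw [map_add]; rfl

/-- The constants make the ordered field of Hahn series an algebra. -/
noncomputable abbrev HahnSeries.lexAlgebra : Algebra R (Lex R⟦Γ⟧) := lexC.toAlgebra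

attribute [local instance] HahnSeries.lexAlgebra

theorem HahnSeries.zero_le_orderTop_C (r : R) : 0 ≤ (C r : R⟦Γ⟧).orderTop := by
  rw [zero_le_orderTop_iff, order_C]

theorem HahnSeries.orderTop_C {r : R} (hr : r ≠ 0) : (C r : R⟦Γ⟧).orderTop = 0 :=
  orderTop_single hr

theorem HahnSeries.isInfiniteOver_of_orderTop_neg {x : Lex R⟦Γ⟧} (hx : 0 < x)
    (h : (ofLex x).orderTop < 0) : IsInfiniteOver R x := fun r =>
  (le_abs_self _).trans_lt ((abs_lt_abs_of_orderTop_ofLex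
    (h.trans_le (zero_le_orderTop_C r))).trans_eq (abs_of_pos hx))

variable [IsRealClosed R]

theorem HahnSeries.isInfinitesimalOver_of_orderTop_pos {x : Lex R⟦Γ⟧}
    (h : 0 < (ofLex x).orderTop) : IsInfinitesimalOver R x := fun r hr => by
  have h0 := IsRealClosed.strictMono (algebraMap R (Lex R⟦Γ⟧)) hr
  rw [map_zero] at h0
  rw [← abs_of_pos h0]
  refine abs_lt_abs_of_orderTop_ofLex ?_
  rwa [show ofLex (algebraMap R (Lex R⟦Γ⟧) r) = C r from rfl, orderTop_C hr.ne']

theorem HahnSeries.isInfinitesimalOver_sub_coeff_zero {x : Lex R⟦Γ⟧}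
    (h : 0 ≤ (ofLex x).orderTop) :
    IsInfinitesimalOver R (x - algebraMap R _ ((ofLex x).coeff 0)) := by
  refine isInfinitesimalOver_of_orderTop_pos (lt_of_le_of_ne ?_ (Ne.symm ?_))
  · exact (le_min h (zero_le_orderTop_C _)).trans min_orderTop_le_orderTop_sub
  · refine orderTop_ne_of_coeff_eq_zero ?_
    change (ofLex x - C ((ofLex x).coeff 0)).coeff 0 = 0
    rw [coeff_sub, C_apply, coeff_single_same, sub_self]

/-- The ordered field of Hahn series has standard parts. -/
theorem HahnSeries.hasStandardParts : HasStandardParts R (Lex R⟦Γ⟧) := by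
  rintro x ⟨c, hc⟩
  refine ⟨_, isInfinitesimalOver_sub_coeff_zero ?_⟩
  by_contra! h
  have h1 : (ofLex |x|).orderTop < 0 := by rwa [orderTop_abs]
  have hx : 0 < |x| := abs_pos.2 (by rintro rfl; simp at h)
  exact absurd hc (isInfiniteOver_of_orderTop_neg hx h1 c).not_ge

theorem HahnSeries.orderTop_neg_of_isInfiniteOver {x : Lex R⟦Γ⟧} (hx : IsInfiniteOver R x) :
    (ofLex x).orderTop < 0 := by
  by_contra! h
  have h1 := (abs_lt.1 (isInfinitesimalOver_sub_coeff_zero h 1 one_pos)).2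
  have h2 := hx ((ofLex x).coeff 0 + 1)
  rw [map_add] at h2
  linarith

/-- The ordered field of Hahn series with exponents in an archimedean group has rank one. -/
theorem HahnSeries.isRankLEOneOver [Archimedean Γ] : IsRankLEOneOver R (Lex R⟦Γ⟧) := by
  intro f g hf
  have h1 := orderTop_neg_of_isInfiniteOver hf
  have hf0 : ofLex f ≠ 0 := by rintro h; simp [h] at h1
  have h2 : (ofLex f).order < 0 := by
    rw [← order_eq_orderTop_of_ne_zero hf0] at h1
    exact_mod_cast h1
  -- The order of `f ^ n` is `n` times that of `f`, so for large `n` it drops below the order of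
  -- `g`.
  obtain ⟨n, hn⟩ := exists_lt_nsmul (neg_pos.2 h2) (-(ofLex g).order)
  refine ⟨n, (le_abs_self g).trans_lt ((abs_lt_abs_of_orderTop_ofLex ?_).trans_eq
    (abs_of_pos (pow_pos hf.pos n)))⟩
  have h3 : (ofLex (f ^ n)).order = n • (ofLex f).order := order_pow _ n
  have h4 : ofLex (f ^ n) ≠ 0 := pow_ne_zero n hf0
  by_cases hg : ofLex g = 0
  · rw [hg, orderTop_zero, ← order_eq_orderTop_of_ne_zero h4]
    exact WithTop.coe_lt_top _
  · rw [← order_eq_orderTop_of_ne_zero hg, ← order_eq_orderTop_of_ne_zero h4, h3]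
    rw [smul_neg, neg_lt_neg_iff] at hn
    exact_mod_cast hn

end LexHahn

section Exponentials

open PowerSeries

theorem PowerSeries.derivative_rescale_exp {R : Type*} [CommRing R] [Algebra ℚ R] (a : R) :
    derivative R (rescale a (exp R)) = a • rescale a (exp R) := by
  ext n
  have h : PowerSeries.coeff (n + 1) (exp R) * (n + 1) = PowerSeries.coeff n (exp R) := by
    rw [← coeff_derivative, derivative_exp]
  rw [coeff_derivative, coeff_rescale, PowerSeries.coeff_smul, coeff_rescale, ← h]
  simp only [smul_eq_mul]
  ring

variable {R : Type*} [Field R] [CharZero R]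

/-- Eigenvectors of differentiation for distinct eigenvalues. -/
theorem PowerSeries.linearIndependent_rescale_exp :
    LinearIndependent R fun a : R => rescale a (exp R) := by
  refine Module.End.eigenvectors_linearIndependent' (derivative R).toLinearMap id
    Function.injective_id _ fun a => ⟨?_, ?_⟩
  · rw [Module.End.mem_eigenspace_iff]
    exact derivative_rescale_exp a
  · intro h
    have := congrArg constantCoeff h
    rw [← coeff_zero_eq_constantCoeff_apply, coeff_rescale, coeff_exp] at this
    simp at this

/-- Exponentials of rationally independent multiples of the variable are algebraically
independent. -/
theorem PowerSeries.algebraicIndependent_rescale_exp {ι : Type*} {b : ι → R}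
    (hb : LinearIndependent ℚ b) : AlgebraicIndependent R fun i => rescale (b i) (exp R) := by
  have hb' : LinearIndependent ℕ b := hb.restrict_scalars' ℕ
  rw [algebraicIndependent_iff]
  intro p hp
  -- A monomial in the exponentials is again an exponential. Rational independence makes the
  -- exponents distinct, which reduces the claim to linear independence.
  have hprod (d : ι →₀ ℕ) : d.prod (fun i n => rescale (b i) (exp R) ^ n) =
      rescale (d.sum fun i n => n • b i) (exp R) := by
    have h (i : ι) (n : ℕ) : rescale (b i) (exp R) ^ n = rescale (n • b i) (exp R) := by
      induction n with
      | zero => rw [pow_zero, zero_smul]; ext n; simp [coeff_one]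
      | succ n ih => rw [pow_succ, ih, exp_mul_exp_eq_exp_add, succ_nsmul]
    simp only [Finsupp.prod, Finsupp.sum, h]
    induction d.support using Finset.cons_induction with
    | empty =>
      rw [Finset.prod_empty, Finset.sum_empty]
      ext n; simp [coeff_one]
    | cons i s hi ih => rw [Finset.prod_cons, Finset.sum_cons, ih, exp_mul_exp_eq_exp_add]
  have hli : LinearIndependent R fun d : ι →₀ ℕ =>
      rescale (d.sum fun i n => n • b i) (exp R) :=
    linearIndependent_rescale_exp.comp _ hb'
  have := linearIndependent_iff'.1 hli p.support p.coeff (by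
    rw [← hp, MvPolynomial.aeval_def, MvPolynomial.eval₂_eq]
    refine Finset.sum_congr rfl fun d _ => ?_
    rw [Algebra.smul_def, ← hprod]; rfl)
  ext d
  by_cases hd : d ∈ p.support
  · exact this d hd
  · exact MvPolynomial.notMem_support_iff.1 hd

end Exponentials

end

/-! ### Construction of the two fields. -/

section

open HahnSeries Cardinal

/-- A real closed field is infinite dimensional over the rationals. -/
theorem IsRealClosed.not_finiteDimensional_rat (R : Type*) [Field R] [LinearOrder R]
    [IsStrictOrderedRing R] [IsRealClosed R] : ¬ FiniteDimensional ℚ R := by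
  intro h
  -- A root of `X ^ p - 2`, with `p` an odd prime above the supposed dimension, has too large a
  -- degree. Irreducibility follows as `p` does not divide the 2-adic valuation of `2`.
  obtain ⟨p, hp, hpp⟩ := Nat.exists_infinite_primes (Module.finrank ℚ R + 3)
  have hodd : Odd p := hpp.odd_of_ne_two (by omega)
  have hirr : Irreducible (Polynomial.X ^ p - Polynomial.C (2 : ℚ)) := by
    refine X_pow_sub_C_irreducible_of_prime hpp fun b hb => ?_
    have h1 := congrArg (padicValRat 2) hb
    have h2 : padicValRat 2 (2 : ℚ) = 1 := by exact_mod_cast padicValRat.self (p := 2) one_lt_two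
    have hb0 : b ≠ 0 := by rintro rfl; rw [zero_pow hpp.ne_zero] at hb; norm_num at hb
    rw [padicValRat.pow, h2] at h1
    have h3 : (p : ℤ) ∣ 1 := ⟨_, h1.symm⟩
    have := Int.eq_one_of_dvd_one (by positivity) h3
    have := hpp.one_lt
    omega
  have hdeg : (Polynomial.X ^ p - Polynomial.C (2 : ℚ)).natDegree = p :=
    Polynomial.natDegree_X_pow_sub_C
  obtain ⟨y, hy⟩ := IsRealClosed.exists_isRoot_of_odd_natDegree
    (f := (Polynomial.X ^ p - Polynomial.C (2 : ℚ)).map (algebraMap ℚ R))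
    (by rwa [Polynomial.natDegree_map, hdeg])
  rw [Polynomial.IsRoot, Polynomial.eval_map_algebraMap] at hy
  have h1 := minpoly.natDegree_le (A := ℚ) y
  rw [← minpoly.eq_of_irreducible_of_monic hirr hy
    (Polynomial.monic_X_pow_sub_C _ hpp.ne_zero), hdeg] at h1
  omega

theorem IsRealClosed.mk_eq_mk_basis {R : Type u} [Field R] [LinearOrder R]
    [IsStrictOrderedRing R] [IsRealClosed R] {ι : Type u} (b : Module.Basis ι ℚ R) : #ι = #R := by
  have hι : Infinite ι := by
    by_contra h
    rw [not_infinite_iff_finite] at h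
    exact IsRealClosed.not_finiteDimensional_rat R (Module.Finite.of_basis b)
  rw [b.repr.toEquiv.cardinal_eq, mk_finsupp_lift_of_infinite]
  simp

section

variable {N : Type*} [Field N] [LinearOrder N] [IsStrictOrderedRing N]

theorem MulArchimedeanClass.strictMono_mk_of_pow_lt {ι : Type*} [Preorder ι]
    {X : ι → {x : N // 0 < x}} (h1 : ∀ i, (1 : N) < X i)
    (h : ∀ i j, i < j → ∀ n : ℕ, (X j : N) ^ n < X i) : StrictMono fun i => mk (X i) := by
  intro i j hij
  have habs (i : ι) : |X i|ₘ = X i := mabs_of_one_le (h1 i).le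
  refine mk_lt_mk.2 fun n => ?_
  rw [habs, habs, ← Subtype.coe_lt_coe, Positive.val_pow]
  exact h i j hij n

variable {R : Type*} [Field R] [LinearOrder R] [IsStrictOrderedRing R]
  [Algebra R N]

/-- Otherwise a power of `|s|` or of its inverse, an element of `R`, would bound the infinite `x`.
-/
theorem IsInfiniteOver.mk_posAbs_ne {x : N} (hx : IsInfiniteOver R x) (hx0 : 0 < x) {s : R}
    (hs : algebraMap R N s ≠ 0) :
    MulArchimedeanClass.mk (posAbs (algebraMap R N s) hs) ≠ MulArchimedeanClass.mk ⟨x, hx0⟩ := by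
  intro h
  obtain ⟨-, n, hn⟩ := MulArchimedeanClass.mk_eq_mk.1 h.symm
  obtain ⟨t, ht⟩ : ∃ t : R, algebraMap R N t = |algebraMap R N s| := by
    rcases abs_choice (algebraMap R N s) with h | h
    · exact ⟨s, h.symm⟩
    · exact ⟨-s, by rw [h, map_neg]⟩
  obtain ⟨u, hu⟩ : ∃ u : R, algebraMap R N u =
      (|posAbs (algebraMap R N s) hs|ₘ : {x : N // 0 < x}) := by
    rcases mabs_choice (posAbs (algebraMap R N s) hs) with h | h
    · exact ⟨t, by rw [h, ht]; rfl⟩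
    · exact ⟨t⁻¹, by rw [h, map_inv₀, ht]; rfl⟩
  have h1 : x ≤ algebraMap R N (u ^ n) := by
    rw [map_pow, hu, ← Positive.val_pow]
    exact (le_mabs_self (⟨x, hx0⟩ : {x : N // 0 < x})).trans hn
  exact absurd (hx _) h1.not_gt

end

attribute [local instance] HahnSeries.lexAlgebra

section

variable (R : Type u) [Field R] [LinearOrder R] [IsStrictOrderedRing R]

/-- A real closed field has a real closed extension of rank one with standard parts whose
transcendence degree is the cardinality of the base. -/
theorem exists_hasStandardParts_isRankLEOneOver [IsRealClosed R] :
    ∃ (M : Type u) (_ : Field M) (_ : LinearOrder M) (_ : IsStrictOrderedRing M)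
      (_ : Algebra R M), IsRealClosed M ∧ HasStandardParts R M ∧ IsRankLEOneOver R M ∧
      Algebra.trdeg R M = #R := by
  let b := Module.Basis.ofVectorSpace ℚ R
  let g : PowerSeries R →ₐ[R] Lex R⟦ℤ⟧ :=
    { toFun p := toLex (ofPowerSeries ℤ R p)
      map_one' := by rw [map_one]; rfl
      map_mul' x y := by rw [map_mul]; rfl
      map_zero' := by rw [map_zero]; rfl
      map_add' x y := by rw [map_add]; rfl
      commutes' r := congrArg toLex (ofPowerSeries_C r) }
  have hg : Function.Injective g := fun x y h => ofPowerSeries_injective (toLex.injective h)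
  obtain ⟨K, M, _, _, _, _, _, _, _, _, _, _, f, y, hM, hFK, hmono, hf, hy, -⟩ :=
    exists_isRealClosed_isTranscendenceBasis
      ((PowerSeries.algebraicIndependent_rescale_exp b.linearIndependent).map' hg)
  refine ⟨M, inferInstance, inferInstance, inferInstance, inferInstance, hM, ?_, ?_, ?_⟩
  · exact (hasStandardParts.of_isAlgebraic hmono).of_algHom f hf
  · exact (IsRankLEOneOver.of_isAlgebraic hasStandardParts isRankLEOneOver hmono).of_algHom f hf
  · rw [← hy.cardinalMk_eq_trdeg, IsRealClosed.mk_eq_mk_basis b]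

/-- An ordered field has a real closed extension with a transcendence basis, indexed by the base,
of infinite elements no power of which exceeds the previous ones. -/
theorem exists_isTranscendenceBasis_pow_lt :
    ∃ (N : Type u) (_ : Field N) (_ : LinearOrder N) (_ : IsStrictOrderedRing N)
      (_ : Algebra R N) (X : R → N), IsRealClosed N ∧ IsTranscendenceBasis R X ∧
      (∀ i, IsInfiniteOver R (X i)) ∧ ∀ i j, i < j → ∀ n : ℕ, X j ^ n < X i := by
  -- Lexicographically `e i` exceeds every multiple of `e j` for `i < j`, so the monomial `x i` with
  -- exponent `-e i` exceeds every power of `x j`.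
  let e : R → Lex (R →₀ ℤ) := fun i => toLex (Finsupp.single i 1)
  let x : R → Lex R⟦Lex (R →₀ ℤ)⟧ := fun i => toLex (single (-e i) 1)
  have hx (i : R) : (ofLex (x i)).orderTop = ((-e i : Lex (R →₀ ℤ)) : WithTop _) :=
    orderTop_single one_ne_zero
  have hpos (i : R) : 0 < x i := by
    rw [← leadingCoeff_pos_iff]
    change 0 < (single (-e i) (1 : R)).leadingCoeff
    rw [leadingCoeff_of_single]
    exact one_pos
  have he (i j : R) (hij : i < j) (n : ℕ) : n • e j < e i := by
    rw [Finsupp.Lex.lt_iff]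
    refine ⟨i, fun k hk => ?_, ?_⟩
    · change n • Finsupp.single j (1 : ℤ) k = Finsupp.single i (1 : ℤ) k
      rw [Finsupp.single_eq_of_ne (hk.trans hij).ne, Finsupp.single_eq_of_ne hk.ne, smul_zero]
    · change n • Finsupp.single j (1 : ℤ) i < Finsupp.single i (1 : ℤ) i
      rw [Finsupp.single_eq_of_ne hij.ne, Finsupp.single_eq_same, smul_zero]
      exact one_pos
  have hinf (i : R) : IsInfiniteOver R (x i) := by
    refine isInfiniteOver_of_orderTop_neg (hpos i) ?_
    rw [hx]
    have := he i (i + 1) (lt_add_one i) 0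
    rw [zero_smul] at this
    exact_mod_cast neg_neg_of_pos this
  have hlt (i j : R) (hij : i < j) (n : ℕ) : x j ^ n < x i := by
    rw [← abs_of_pos (hpos i), ← abs_of_pos (pow_pos (hpos j) n)]
    refine abs_lt_abs_of_orderTop_ofLex ?_
    have h1 : ofLex (x j ^ n) = single (n • -e j) 1 := by
      change single (-e j) (1 : R) ^ n = _
      rw [single_pow, one_pow]
    rw [hx, h1, orderTop_single one_ne_zero]
    rw [WithTop.coe_lt_coe]
    exact (neg_lt_neg (he i j hij n)).trans_eq (neg_nsmul _ _).symm
  have hind : AlgebraicIndependent R x :=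
    algebraicIndependent_of_mulArchimedeanClass (fun i => ⟨x i, hpos i⟩)
      (MulArchimedeanClass.strictMono_mk_of_pow_lt
        (fun i => by simpa using hinf i 1)
        (fun i j hij n => hlt i j hij n))
      (fun i n => by simpa using hinf i n)
      (fun i s hs => (hinf i).mk_posAbs_ne (hpos i) hs)
  obtain ⟨K, N, _, _, _, _, _, _, _, _, _, _, f, y, hN, -, hmono, hf, hy, hfy⟩ :=
    exists_isRealClosed_isTranscendenceBasis hind
  refine ⟨N, inferInstance, inferInstance, inferInstance, inferInstance, y, hN, hy,
    fun i r => hf.lt_iff_lt.1 ?_, fun i j hij n => hf.lt_iff_lt.1 ?_⟩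
  · rw [hfy, f.commutes]
    exact (hinf i).map (IsScalarTower.toAlgHom R _ K) hmono r
  · rw [map_pow, hfy, hfy, ← map_pow]
    exact hmono (hlt i j hij n)

end

end

/-! ### Rank one subextensions of the second field. -/

section

open Cardinal

set_option linter.unusedSectionVars false

section

variable {R S N : Type*} [Field R] [LinearOrder R] [IsStrictOrderedRing R]
  [Field S] [LinearOrder S] [IsStrictOrderedRing S]
  [Field N] [LinearOrder N] [IsStrictOrderedRing N] [Algebra R S] [Algebra R N]

theorem AlgHom.map_abs_of_strictMono (g : S →ₐ[R] N) (hg : StrictMono g) (s : S) :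
    g |s| = |g s| := hg.monotone.map_max.trans (by rw [map_neg]; rfl)

/-- A multiplicative archimedean class of infinite elements that meets a subfield meets it in an
infinite element. -/
theorem IsInfiniteOver.exists_mk_eq {x : N} (hx : IsInfiniteOver R x) (hx0 : 0 < x)
    (g : S →ₐ[R] N) (hg : StrictMono g) {s : S} (hs : g s ≠ 0)
    (h : MulArchimedeanClass.mk (posAbs (g s) hs) = MulArchimedeanClass.mk ⟨x, hx0⟩) :
    ∃ (t : S) (ht : 0 < g t), IsInfiniteOver R t ∧
      MulArchimedeanClass.mk (⟨g t, ht⟩ : {x : N // 0 < x}) =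
        MulArchimedeanClass.mk ⟨x, hx0⟩ := by
  -- Replace `s` by the larger of `|s|` and its inverse.
  obtain ⟨t, ht⟩ : ∃ t : S, g t = (|posAbs (g s) hs|ₘ : {x : N // 0 < x}) := by
    rcases mabs_choice (posAbs (g s) hs) with h | h
    · exact ⟨|s|, by rw [h, g.map_abs_of_strictMono hg]; rfl⟩
    · exact ⟨|s|⁻¹, by rw [h, map_inv₀, g.map_abs_of_strictMono hg]; rfl⟩
  have ht0 : 0 < g t := by rw [ht]; exact |posAbs (g s) hs|ₘ.2
  refine ⟨t, ht0, fun r => ?_, ?_⟩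
  · by_contra! hle
    obtain ⟨-, n, hn⟩ := MulArchimedeanClass.mk_eq_mk.1 h.symm
    have h1 : x ≤ algebraMap R N (r ^ n) := by
      have h2 : x ≤ g t ^ n := by
        rw [ht, ← Positive.val_pow]
        exact (le_mabs_self (⟨x, hx0⟩ : {x : N // 0 < x})).trans hn
      refine h2.trans ?_
      rw [map_pow, ← g.commutes]
      exact pow_le_pow_left₀ ht0.le (hg.monotone hle) n
    exact absurd (hx _) h1.not_gt
  · rw [← h, ← MulArchimedeanClass.mk_mabs (posAbs (g s) hs)]
    congr 1
    exact Subtype.ext ht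

end

/-- A rank one subextension of an extension with a transcendence basis of infinite elements in
distinct multiplicative archimedean classes has transcendence degree at most one. -/
theorem IsRankLEOneOver.trdeg_le_one {R : Type*} {S : Type v} {N : Type u}
    [Field R] [LinearOrder R] [IsStrictOrderedRing R]
    [Field S] [LinearOrder S] [IsStrictOrderedRing S]
    [Field N] [LinearOrder N] [IsStrictOrderedRing N] [Algebra R S] [Algebra R N]
    (hS : IsRankLEOneOver R S) (g : S →ₐ[R] N) (hg : StrictMono g)
    {ι : Type*} [LinearOrder ι] {X : ι → N} (hX : IsTranscendenceBasis R X)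
    (hinf : ∀ i, IsInfiniteOver R (X i)) (hlt : ∀ i j, i < j → ∀ n : ℕ, X j ^ n < X i) :
    Algebra.trdeg R S ≤ 1 := by
  let _ : Algebra S N := g.toRingHom.toAlgebra
  have : IsScalarTower R S N := .of_algebraMap_eq fun r => (g.commutes r).symm
  let Y : ι → {x : N // 0 < x} := fun i => ⟨X i, (hinf i).pos⟩
  have hY : StrictMono fun i => MulArchimedeanClass.mk (Y i) :=
    MulArchimedeanClass.strictMono_mk_of_pow_lt (fun i => by simpa using hinf i 1) hlt
  let A : Set ι := {i | ∀ s : S, ∀ hs : algebraMap S N s ≠ 0,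
    MulArchimedeanClass.mk (posAbs (algebraMap S N s) hs) ≠ MulArchimedeanClass.mk (Y i)}
  -- `A` collects the indices whose class misses `S`. Two indices outside it would give infinite
  -- elements of `S`, one above all powers of the other, against rank one.
  have hA : Aᶜ.Subsingleton := by
    have key (i j : ι) (hi : i ∉ A) (hj : j ∉ A) : ¬ i < j := by
      intro hij
      simp only [A, Set.mem_ofPred_eq, not_forall, not_not] at hi hj
      obtain ⟨s, hs, hsi⟩ := hi
      obtain ⟨t, ht, htj⟩ := hj
      obtain ⟨s', hs', hsinf, hsi'⟩ := (hinf i).exists_mk_eq (hinf i).pos g hg hs hsi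
      obtain ⟨t', ht', htinf, htj'⟩ := (hinf j).exists_mk_eq (hinf j).pos g hg ht htj
      have h1 := hY hij
      simp only [Y] at h1
      rw [← hsi', ← htj', MulArchimedeanClass.mk_lt_mk] at h1
      obtain ⟨n, hn⟩ := hS t' s' htinf
      have habs {a : S} (ha : IsInfiniteOver R a) (h0 : 0 < g a) :
          |(⟨g a, h0⟩ : {x : N // 0 < x})|ₘ = ⟨g a, h0⟩ := by
        refine mabs_of_one_le ?_
        change 1 ≤ g a
        rw [← map_one g]
        exact hg.monotone (by simpa using (ha 1).le)
      have h2 := h1 n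
      rw [habs hsinf, habs htinf, ← Subtype.coe_lt_coe, Positive.val_pow] at h2
      have h3 := hg hn
      rw [map_pow] at h3
      exact absurd h2 h3.not_gt
    intro i hi j hj
    exact le_antisymm (not_lt.1 (key j i hj hi)) (not_lt.1 (key i j hi hj))
  have hindS : AlgebraicIndependent S fun i : A => X i :=
    algebraicIndependent_of_mulArchimedeanClass (fun i : A => Y i)
      (fun i j hij => hY hij) (fun i n => by simpa using hinf i n) fun i s hs => i.2 s hs
  obtain ⟨κ, B, hB⟩ := exists_isTranscendenceBasis' R S
  have hsum : AlgebraicIndependent R (Sum.elim (algebraMap S N ∘ B) fun i : A => X i) := by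
    have := hB.1.sumElim_comp hindS
    rw [← algebraicIndependent_equiv (Equiv.sumComm κ A)] at this
    convert this using 1
    ext (_ | _) <;> rfl
  -- By exchange, the transcendence basis `B` of `S` stays independent over `D`, over which `N` has
  -- transcendence degree at most the size of `Aᶜ`.
  have hB' := (AlgebraicIndependent.sumElim_iff.1 hsum).2
  set D := Algebra.adjoin R (Set.range fun i : A => X i) with hD
  have halg : Algebra.IsAlgebraic (Algebra.adjoin D (X '' Aᶜ)) N := by
    have h1 := hX.isAlgebraic
    have h2 : Algebra.adjoin R (Set.range X) =
        (Algebra.adjoin D (X '' Aᶜ)).restrictScalars R := by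
      rw [← Algebra.adjoin_union_eq_adjoin_adjoin]
      congr 1
      rw [← Set.image_eq_range, ← Set.image_union, Set.union_compl_self, Set.image_univ]
    rw [h2] at h1
    exact h1
  have h1 : Algebra.trdeg D N ≤ 1 :=
    (Algebra.IsAlgebraic.trdeg_le_cardinalMk D (X '' Aᶜ)).trans
      (Cardinal.mk_le_one_iff_set_subsingleton.2 (hA.image X))
  have h2 := hB'.lift_cardinalMk_le_trdeg
  rw [← hB.cardinalMk_eq_trdeg, ← Cardinal.lift_le.{u}, Cardinal.lift_one]
  refine h2.trans ?_
  rw [← Cardinal.lift_one.{u, v}]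
  exact (Cardinal.lift_le.2 h1).trans (by simp)

end

/-! ### Embedding extensions of transcendence degree at most one. -/

section

open Polynomial

section

variable {R E : Type*} [Field R] [LinearOrder R] [IsStrictOrderedRing R]
  [Field E] [LinearOrder E] [IsStrictOrderedRing E] [Algebra R E]

/-- A polynomial with positive leading coefficient is positive, and bounded away from zero, at
infinite elements. -/
theorem IsInfiniteOver.exists_pos_le_aeval (hRE : StrictMono (algebraMap R E)) {t : E}
    (ht : IsInfiniteOver R t) {p : R[X]} (hp : 0 < p.leadingCoeff) :
    ∃ r : R, 0 < r ∧ algebraMap R E r ≤ aeval t p := by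
  induction hn : p.natDegree generalizing p with
  | zero =>
    rw [eq_C_of_natDegree_eq_zero hn, leadingCoeff_C] at hp
    refine ⟨_, hp, ?_⟩
    rw [eq_C_of_natDegree_eq_zero hn, aeval_C, coeff_C_zero]
  | succ n ih =>
    have hd : p.divX.natDegree = n := by rw [natDegree_divX_eq_natDegree_tsub_one, hn]; rfl
    obtain ⟨r, hr, hle⟩ := ih (p := p.divX) (by
      rwa [leadingCoeff, hd, coeff_divX, ← hn]) hd
    refine ⟨1, one_pos, ?_⟩
    have h1 : aeval t p = aeval t p.divX * t + algebraMap R E (p.coeff 0) := by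
      conv_lhs => rw [← divX_mul_X_add p]
      simp
    have h2 := mul_le_mul_of_nonneg_right hle ht.pos.le
    have hr' : 0 < algebraMap R E r := by simpa using hRE hr
    -- The bound on `t` is chosen so that `r t + p(0) > 1`.
    have h3 := mul_lt_mul_of_pos_left (ht ((1 - p.coeff 0) / r)) hr'
    rw [← map_mul, mul_div_cancel₀ _ hr.ne', map_sub] at h3
    rw [h1]
    linarith

theorem IsInfiniteOver.aeval_pos_iff (hRE : StrictMono (algebraMap R E)) {t : E}
    (ht : IsInfiniteOver R t) {p : R[X]} : 0 < aeval t p ↔ 0 < p.leadingCoeff := by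
  have key {q : R[X]} (hq : 0 < q.leadingCoeff) : 0 < aeval t q := by
    obtain ⟨r, hr, hle⟩ := ht.exists_pos_le_aeval hRE hq
    exact (by simpa using hRE hr : 0 < algebraMap R E r).trans_le hle
  refine ⟨fun h => ?_, key⟩
  by_contra! hle
  rcases hle.lt_or_eq with hlt | heq
  · have := key (q := -p) (by rwa [leadingCoeff_neg, neg_pos])
    rw [map_neg] at this
    linarith
  · rw [leadingCoeff_eq_zero.1 heq, map_zero] at h
    exact lt_irrefl _ h

theorem IsInfiniteOver.transcendental (hRE : StrictMono (algebraMap R E)) {t : E}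
    (ht : IsInfiniteOver R t) : Transcendental R t := by
  rw [transcendental_iff]
  intro p hp
  by_contra hp0
  rcases lt_or_gt_of_ne (leadingCoeff_ne_zero.2 hp0) with h | h
  · have := (ht.aeval_pos_iff hRE (p := -p)).2 (by rwa [leadingCoeff_neg, neg_pos])
    rw [map_neg, hp, neg_zero] at this
    exact lt_irrefl _ this
  · exact ((ht.aeval_pos_iff hRE).2 h).ne' hp

/-- A proper extension with standard parts contains an infinite element. -/
theorem HasStandardParts.exists_isInfiniteOver (hRE : StrictMono (algebraMap R E))
    (h : HasStandardParts R E) {s : E} (hs : ∀ r, algebraMap R E r ≠ s) :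
    ∃ t : E, IsInfiniteOver R t := by
  by_cases hb : IsBoundedOver R s
  · obtain ⟨r, hr⟩ := h s hb
    have h0 : 0 < |s - algebraMap R E r| := abs_pos.2 (sub_ne_zero.2 (hs r).symm)
    -- The distance from `s` to its standard part is a nonzero infinitesimal.
    refine ⟨|s - algebraMap R E r|⁻¹, fun c => ?_⟩
    have hc : 0 < |c| + 1 := by positivity
    have h1 := hr (|c| + 1)⁻¹ (inv_pos.2 hc)
    rw [map_inv₀, lt_inv_comm₀ h0 (by simpa using hRE hc)] at h1
    exact (hRE ((le_abs_self c).trans_lt (lt_add_one _))).trans h1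
  · refine ⟨|s|, fun r => ?_⟩
    by_contra! hle
    exact hb ⟨r, hle⟩

end

/-- A real closed extension of transcendence degree at most one with standard parts embeds in every
real closed extension that contains an infinite element. -/
theorem HasStandardParts.nonempty_algHom {R S M : Type*}
    [Field R] [LinearOrder R] [IsStrictOrderedRing R] [IsRealClosed R]
    [Field S] [LinearOrder S] [IsStrictOrderedRing S] [IsRealClosed S]
    [Field M] [LinearOrder M] [IsStrictOrderedRing M] [IsRealClosed M]
    [Algebra R S] [Algebra R M] (hS : HasStandardParts R S) (htr : Algebra.trdeg R S ≤ 1)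
    {m : M} (hm : IsInfiniteOver R m) : Nonempty (S →ₐ[R] M) := by
  have hRS := IsRealClosed.strictMono (algebraMap R S)
  have hRM := IsRealClosed.strictMono (algebraMap R M)
  by_cases halg : Algebra.IsAlgebraic R S
  · refine IsRealClosed.nonempty_algHom_of_isAlgebraic fun k hk => ?_
    rw [← map_zero (algebraMap R S), hRS.lt_iff_lt] at hk
    simpa using hRM hk
  obtain ⟨t, ht⟩ : ∃ t : S, IsInfiniteOver R t := by
    by_contra! hno
    refine halg ⟨fun s => ?_⟩
    by_contra hs
    obtain ⟨t, ht⟩ := hS.exists_isInfiniteOver hRS (s := s) (by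
      rintro r rfl; exact hs (isAlgebraic_algebraMap r))
    exact hno t ht
  have htt := ht.transcendental hRS
  let K := FractionRing R[X]
  have hinjS := transcendental_iff_injective.1 htt
  have hinjM := transcendental_iff_injective.1 (hm.transcendental hRM)
  let gS : K →ₐ[R] S := IsFractionRing.liftAlgHom hinjS
  let gM : K →ₐ[R] M := IsFractionRing.liftAlgHom hinjM
  have hgS (p : R[X]) : gS (algebraMap _ K p) = aeval t p :=
    IsFractionRing.lift_algebraMap hinjS p
  have hgM (p : R[X]) : gM (algebraMap _ K p) = aeval m p :=
    IsFractionRing.lift_algebraMap hinjM p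
  let _ : Algebra K S := gS.toRingHom.toAlgebra
  let _ : Algebra K M := gM.toRingHom.toAlgebra
  have : IsScalarTower R K S := .of_algebraMap_eq fun r => (gS.commutes r).symm
  have : IsScalarTower R K M := .of_algebraMap_eq fun r => (gM.commutes r).symm
  have : Algebra.IsAlgebraic K S := by
    have hb : IsTranscendenceBasis R fun _ : Unit => t :=
      (algebraicIndependent_unique_type_iff.2 htt).isTranscendenceBasis_of_lift_trdeg_le_of_finite
        (by simpa using htr)
    have h1 := hb.isAlgebraic
    rw [Set.range_const] at h1
    let _ : Algebra R[X] S := (aeval t).toRingHom.toAlgebra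
    have : IsScalarTower R[X] K S := .of_algebraMap_eq fun p => (hgS p).symm
    let f : R[X] →ₐ[R] Algebra.adjoin R {t} :=
      aeval ⟨t, Algebra.self_mem_adjoin_singleton R t⟩
    have hf (p : R[X]) : (f p : S) = aeval t p :=
      (aeval_algHom_apply (Algebra.adjoin R {t}).val _ p).symm
    have hfs : Function.Surjective f := by
      rintro ⟨y, hy⟩
      have hy' := hy
      rw [Algebra.adjoin_singleton_eq_range_aeval] at hy'
      obtain ⟨p, hp⟩ := hy'
      exact ⟨p, Subtype.ext ((hf p).trans hp)⟩
    have : Algebra.IsAlgebraic R[X] S :=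
      Algebra.IsAlgebraic.of_ringHom_of_comp_eq f (RingHom.id S) hfs Function.injective_id
        (RingHom.ext hf)
    exact (IsFractionRing.comap_isAlgebraic_iff (A := R[X]) (K := K)).1 this
  -- A fraction `a / b` has the sign of `a b`, which at an infinite element is the sign of the
  -- leading coefficient, in `S` and in `M` alike.
  have hsign (k : K) : 0 < algebraMap K S k → 0 < algebraMap K M k := by
    obtain ⟨a, b, hb, rfl⟩ := IsFractionRing.div_surjective (A := R[X]) k
    have hb0 : b ≠ 0 := nonZeroDivisors.ne_zero hb
    have hb1 : algebraMap R[X] K b ≠ 0 := by simpa using hb0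
    have h1 : algebraMap R[X] K a / algebraMap R[X] K b * algebraMap R[X] K b ^ 2 =
        algebraMap R[X] K (a * b) := by
      rw [map_mul, sq, ← mul_assoc, div_mul_cancel₀ _ hb1]
    intro h
    have h2 : 0 < gS (algebraMap R[X] K (a * b)) := by
      rw [← h1, map_mul, map_pow]
      exact mul_pos h (sq_pos_of_ne_zero ((map_ne_zero gS).2 hb1))
    rw [hgS, ht.aeval_pos_iff hRS, ← hm.aeval_pos_iff hRM, ← hgM, ← h1, map_mul, map_pow] at h2
    exact pos_of_mul_pos_left h2 (sq_nonneg _)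
  obtain ⟨f⟩ := IsRealClosed.nonempty_algHom_of_isAlgebraic hsign
  exact ⟨f.restrictScalars R⟩

end

theorem proposition4p6 (R : Type u) [Field R] [LinearOrder R] [IsStrictOrderedRing R]
    [IsRealClosed R] :
    ∃ (M N : Type u) (_ : Field M) (_ : Field N) (_ : Algebra R M) (_ : Algebra R N),
      IsRealClosed M ∧ IsRealClosed N ∧
      Algebra.trdeg R M = Cardinal.mk R ∧ Algebra.trdeg R N = Cardinal.mk R ∧
      ∀ (S : Type v) [Field S] [LinearOrder S] [IsStrictOrderedRing S] [IsRealClosed S]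
        [Algebra R S],
        (Nonempty (S →ₐ[R] M) ∧ Nonempty (S →ₐ[R] N)) ↔
          (Algebra.trdeg R S ≤ 1 ∧ IsDedekindCompleteIn R S) := by
  obtain ⟨M, _, _, _, _, hM, hMst, hMrk, hMtr⟩ := exists_hasStandardParts_isRankLEOneOver R
  obtain ⟨N, _, _, _, _, X, hN, hX, hXinf, hXlt⟩ := exists_isTranscendenceBasis_pow_lt R
  -- Without infinite elements standard parts would make `M` algebraic over `R`, but its
  -- transcendence degree is `#R ≠ 0`.
  obtain ⟨m, hm⟩ : ∃ m : M, IsInfiniteOver R m := by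
    by_contra! hno
    have halg : Algebra.trdeg R M = 0 := by
      have : Algebra.IsAlgebraic R M := ⟨fun s => by
        by_contra hs
        obtain ⟨t, ht⟩ := hMst.exists_isInfiniteOver
          (IsRealClosed.strictMono (algebraMap R M)) (s := s) (by
            rintro r rfl; exact hs (isAlgebraic_algebraMap r))
        exact hno t ht⟩
      exact trdeg_eq_zero
    rw [halg] at hMtr
    exact Cardinal.mk_ne_zero R hMtr.symm
  refine ⟨M, N, inferInstance, inferInstance, inferInstance, inferInstance, hM, hN, hMtr,
    hX.cardinalMk_eq_trdeg.symm, fun S _ _ _ _ _ => ⟨?_, ?_⟩⟩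
  · rintro ⟨⟨f⟩, ⟨g⟩⟩
    have hf : StrictMono f := IsRealClosed.strictMono f.toRingHom
    have hg : StrictMono g := IsRealClosed.strictMono g.toRingHom
    exact ⟨(hMrk.of_algHom f hf).trdeg_le_one g hg hX hXinf hXlt,
      (hMst.of_algHom f hf).isDedekindCompleteIn (IsRealClosed.strictMono (algebraMap R S))⟩
  · rintro ⟨htr, hD⟩
    have hst := hD.hasStandardParts (IsRealClosed.strictMono (algebraMap R S))
    exact ⟨hst.nonempty_algHom htr hm, hst.nonempty_algHom htr (hXinf 0)⟩
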